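/- **The model.** Let $\boldsymbol\alpha=(\alpha_1,\alpha_2,\dots)$ with $\alpha_i\in[0,\infty]$, and put $$\psi_j(\boldsymbol\alpha)=\sum_{i=1}^{j}\binom ji\alpha_i,\qquad \tau_j(\boldsymbol\alpha)=j+1-\sum_{i=1}^{j}\psi_i(\boldsymbol\alpha),\qquad \mathcal D_j=\{\boldsymbol\alpha:\psi_j(\boldsymbol\alpha)<1<\psi_{j+1}(\boldsymbol\alpha)\},$$ and $q=\min\{i\ge 1:\alpha_i>0\}$. For each $i\ge1$ let $G_i$ be the distribution function of a positive random variable with finite mean $\mu_i$, and assume that there is $a>0$ with $G_i(a)\le 1/2$ for all $i\ge q$. For $n\ge 1$ let $p_i=n^{-\alpha_i}$ (with $n^{-\infty}=0$). To every $A\subseteq[n]=\{1,\dots,n\}$ with $|A|=i+1\ge 2$ attach random variables $D_A$, $(Z_{A,j})_{j\ge2}$, $(I_{A,j})_{j\ge0}$, where $\mathbb P(D_A\le x)=\mu_i^{-1}\int_0^x(1-G_i(y))\,dy$ for $x\ge0$, each $Z_{A,j}$ has distribution function $G_i$, and each $I_{A,j}$ is Bernoulli with parameter $p_i$; for fixed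 $n$ all these variables (over all $A$ and $j$) are independent. With $S_{A,0}=0$ and $S_{A,j}=D_A+\sum_{\ell=2}^{j}Z_{A,\ell}$ for $j\ge1$, let $$\Delta_A(t)=\sum_{j\ge0}\mathbf 1\{S_{A,j}\le t<S_{A,j+1}\}\,I_{A,j},\qquad t\ge0.$$ The dynamic multi-parameter simplicial complex $X_n(t)$ on the vertex set $[n]$ consists of all nonempty $A\subseteq[n]$ such that $\Delta_B(t)=1$ for every $B\subseteq A$ with $|B|\ge2$. Let $\chi_n(t)=\sum_{j=0}^{n-1}(-1)^jf_{j,n}(t)$ be its Euler characteristic, $f_{j,n}(t)$ being the number of its $j$-dimensional faces, and let $\beta_{j,n}(t)$ be its $j$-th reduced Betti number (with coefficients in an arbitrary fixed field). The complexes for different $n$ live on one common probability space, with an arbitrary joint law. **Theorem 4.1.** Assume that $\boldsymbol\alpha\in\mathcal D_k$ for some $k\ge q$. Then, almost surely, the paths $t\mapsto\chi_n(t)$ and $t\mapsto\beta_{k,n}(t)$ belong for all $n$ to the space $D[0,\infty)$ of right continuous functions with left limits, and, as $n\to\infty$, $$\left(\frac{\chi_n(t)}{n^{\tau_k(\boldsymbol\alpha)}},\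 t\ge0\right)\to\frac{(-1)^k}{(k+1)!}\quad\text{a.s.}\qquad\text{and}\qquad\left(\frac{\beta_{k,n}(t)}{n^{\tau_k(\boldsymbol\alpha)}},\ t\ge0\right)\to\frac1{(k+1)!}\quad\text{a.s.}$$ in the Skorokhod $J_1$ topology on $D[0,\infty)$, the right-hand sides being viewed as constant elements of $D[0,\infty)$. -/

import Mathlib

open MeasureTheory ProbabilityTheory Filter Topology
open scoped ENNReal NNReal Nat

noncomputable section

namespace DynComplex

/-! ### The exponents -/

/-- `ψ_j(α) = ∑_{i=1}^j C(j,i) α_i`, for `α = (α₁, α₂, …)` with entries in `[0,∞]`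
(the value `α 0` is never used). -/
def psi (α : ℕ → ℝ≥0∞) (j : ℕ) : ℝ≥0∞ :=
  ∑ i ∈ Finset.Icc 1 j, (j.choose i : ℝ≥0∞) * α i

/-- `τ_j(α) = j + 1 - ∑_{i=1}^j ψ_i(α)`, with values in `[-∞,∞)`. -/
def tau (α : ℕ → ℝ≥0∞) (j : ℕ) : EReal :=
  ((j + 1 : ℕ) : EReal) - ((∑ i ∈ Finset.Icc 1 j, psi α i : ℝ≥0∞) : EReal)

/-- `𝒟_j = {α : ψ_j(α) < 1 < ψ_{j+1}(α)}`; as `ψ_0 = 0`, for `j = 0` this is `{ψ_1 > 1}`. -/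
def critRegion (j : ℕ) : Set (ℕ → ℝ≥0∞) :=
  {α | psi α j < 1 ∧ 1 < psi α (j + 1)}

/-- `q(α) = min {i ≥ 1 : α_i > 0}`. -/
def lowestDim (α : ℕ → ℝ≥0∞) : ℕ := sInf {i | 1 ≤ i ∧ 0 < α i}

/-- `n^{-a}` for `a ∈ [0,∞]`, with `n^{-∞} = 0`. -/
def faceProb (n : ℕ) (a : ℝ≥0∞) : ℝ :=
  if a = ∞ then 0 else (n : ℝ) ^ (-a.toReal)

/-! ### The stationary on/off processes -/

/-- The potential simplices of positive dimension on the vertex set `[n]`. -/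
def Simplex (n : ℕ) : Type := {A : Finset (Fin n) // 2 ≤ A.card}

/-- The dimension `|A| - 1` of a simplex. -/
def Simplex.dim {n : ℕ} (A : Simplex n) : ℕ := A.1.card - 1

/-- Labels of the random variables that drive one on/off process: the delay `D`, the
interarrival times (`gap ℓ` is `Z_{ℓ+2}`), and the states (`state j` is `I_j`). -/
inductive RenewalVar : Type
  | delay : RenewalVar
  | gap : ℕ → RenewalVar
  | state : ℕ → RenewalVar

/-- The renewal times `S_0 = 0`, `S_j = D + Z_2 + ⋯ + Z_j` for `j ≥ 1`. -/
def renewalTime (x : RenewalVar → ℝ) : ℕ → ℝ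
  | 0 => 0
  | j + 1 => x .delay + ∑ l ∈ Finset.range j, x (.gap l)

/-- `Δ(t) = ∑_j 𝟙{S_j ≤ t < S_{j+1}} I_j`. -/
def onOff (x : RenewalVar → ℝ) (t : ℝ≥0) : ℝ :=
  ∑' j : ℕ, (Set.Ico (renewalTime x j) (renewalTime x (j + 1))).indicator
    (fun _ => x (.state j)) (t : ℝ)

/-- The equilibrium distribution function `G_e(x) = μ⁻¹ ∫_0^x (1 - G(y)) dy` of a law `ν` with
distribution function `G` and mean `μ`. -/
def equilibriumCdf (ν : Measure ℝ) (x : ℝ) : ℝ :=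
  (1 / ∫ z, z ∂ν) * ∫ y in (0 : ℝ)..x, (1 - cdf ν y)

/-- The random variables driving the on/off processes of all simplices on `[n]`: all of them are
independent; for a simplex of dimension `i`, the interarrival times have law `ν i`, the delay has
the corresponding equilibrium distribution, and the states are Bernoulli with parameter `p i`. -/
structure IsDrivingFamily {Ω : Type*} [MeasurableSpace Ω] (P : Measure Ω) (n : ℕ)
    (p : ℕ → ℝ) (ν : ℕ → Measure ℝ) (ξ : Simplex n → RenewalVar → Ω → ℝ) : Prop where
  measurable : ∀ A v, Measurable (ξ A v)
  indep : iIndepFun (fun a : Simplex n × RenewalVar => ξ a.1 a.2) P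
  gap_law : ∀ A l, P.map (ξ A (.gap l)) = ν A.dim
  delay_law : ∀ A (x : ℝ), 0 ≤ x →
    P.real {ω | ξ A .delay ω ≤ x} = equilibriumCdf (ν A.dim) x
  state_law : ∀ A j, P.real {ω | ξ A (.state j) ω = 1} = p A.dim ∧
    P.real {ω | ξ A (.state j) ω = 0} = 1 - p A.dim

/-- The complex at time `t`: a nonempty `A ⊆ [n]` is a face iff every `B ⊆ A` with `|B| ≥ 2`
is "on" at time `t`. -/
def complexAt {n : ℕ} (x : Simplex n → RenewalVar → ℝ) (t : ℝ≥0) :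
    AbstractSimplicialComplex (Fin n) where
  faces := {A | A.Nonempty ∧ ∀ B : Simplex n, B.1 ⊆ A → onOff (x B) t = 1}
  isRelLowerSet_faces := by
    intro A hA
    refine ⟨hA.1, fun B hBA hB => ⟨hB, fun C hC => hA.2 C (hC.trans hBA)⟩⟩
  singleton_mem := by
    intro v
    refine ⟨Finset.singleton_nonempty v, fun B hB => ?_⟩
    have h1 := Finset.card_le_card hB
    have h2 := B.2
    simp at h1
    omega

/-! ### Euler characteristic and reduced Betti numbers -/

/-- The number of `j`-dimensional faces. -/
def faceCount {n : ℕ} (X : AbstractSimplicialComplex (Fin n)) (j : ℕ) : ℕ :=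
  {A : Finset (Fin n) | A ∈ X.faces ∧ A.card = j + 1}.ncard

/-- The Euler characteristic `∑_{j=0}^{n-1} (-1)^j f_j`. -/
def eulerChar {n : ℕ} (X : AbstractSimplicialComplex (Fin n)) : ℤ :=
  ∑ j ∈ Finset.range n, (-1) ^ j * (faceCount X j : ℤ)

/-- The augmented simplicial chains with `m` vertices, i.e. of dimension `m - 1`: combinations
of the faces with `m` vertices, where the empty set counts as the face of dimension `-1`. -/
def chains (K : Type*) [Field K] {n : ℕ} (X : AbstractSimplicialComplex (Fin n)) (m : ℕ) :
    Submodule K (Finset (Fin n) →₀ K) :=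
  Finsupp.supported K K {A | (A = ∅ ∨ A ∈ X.faces) ∧ A.card = m}

/-- The boundary operator: `∂[v_0 < ⋯ < v_m] = ∑_i (-1)^i [v_0, …, v̂_i, …, v_m]`. -/
def boundary (K : Type*) [Field K] (n : ℕ) :
    (Finset (Fin n) →₀ K) →ₗ[K] (Finset (Fin n) →₀ K) :=
  Finsupp.linearCombination K fun A =>
    ∑ v ∈ A, Finsupp.single (A.erase v) ((-1 : K) ^ (A.filter (· < v)).card)

/-- The `j`-cycles. -/
def cycles (K : Type*) [Field K] {n : ℕ} (X : AbstractSimplicialComplex (Fin n)) (j : ℕ) :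
    Submodule K (Finset (Fin n) →₀ K) :=
  chains K X (j + 1) ⊓ LinearMap.ker (boundary K n)

/-- The `j`-boundaries. -/
def boundaries (K : Type*) [Field K] {n : ℕ} (X : AbstractSimplicialComplex (Fin n)) (j : ℕ) :
    Submodule K (Finset (Fin n) →₀ K) :=
  (chains K X (j + 2)).map (boundary K n)

/-- The dimension of `Z / B` for subspaces `B ⊆ Z`. -/
def quotientDim {K V : Type*} [Field K] [AddCommGroup V] [Module K V] (Z B : Submodule K V) : ℕ :=
  Module.finrank K (Z ⧸ B.submoduleOf Z)

/-- The `j`-th reduced Betti number over `K`: the dimension of cycles modulo boundaries. -/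
def betti (K : Type*) [Field K] {n : ℕ} (X : AbstractSimplicialComplex (Fin n)) (j : ℕ) : ℕ :=
  quotientDim (cycles K X j) (boundaries K X j)

/-! ### The space `D[0,∞)` with the Skorokhod `J₁` topology -/

/-- `D[0,∞)`: right continuous real functions on `[0,∞)` with left limits. -/
structure Cadlag where
  toFun : ℝ≥0 → ℝ
  right_cont : ∀ t, ContinuousWithinAt toFun (Set.Ici t) t
  left_lim : ∀ t, ∃ l, Tendsto toFun (𝓝[<] t) (𝓝 l)

/-- The basic `J₁` neighbourhood of `x`: those `y` for which some increasing bijection `λ` of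
`[0,∞)` satisfies `|λ t - t| ≤ ε` for all `t` and `|y (λ t) - x t| ≤ ε` for all `t ≤ T`. -/
def j1Nhd (x : Cadlag) (ε : ℝ) (T : ℝ≥0) : Set Cadlag :=
  {y | ∃ l : ℝ≥0 ≃o ℝ≥0, (∀ t, |((l t : ℝ≥0) : ℝ) - t| ≤ ε) ∧
    ∀ t ≤ T, |y.toFun (l t) - x.toFun t| ≤ ε}

theorem j1Nhd_mono (x : Cadlag) {ε ε' : ℝ} {T T' : ℝ≥0} (hε : ε ≤ ε') (hT : T' ≤ T) :
    j1Nhd x ε T ⊆ j1Nhd x ε' T' := by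
  rintro y ⟨l, h1, h2⟩
  exact ⟨l, fun t => (h1 t).trans hε, fun t ht => (h2 t (ht.trans hT)).trans hε⟩

/-- The `J₁` topology on `D[0,∞)`. A sequence `y_m` converges to `x` iff there are increasing
bijections `λ_m` of `[0,∞)` with `sup_t |λ_m t - t| → 0` and
`sup_{t ≤ T} |y_m (λ_m t) - x t| → 0` for every `T`. -/
instance : TopologicalSpace Cadlag where
  IsOpen U := ∀ x ∈ U, ∃ ε > 0, ∃ T, j1Nhd x ε T ⊆ U
  isOpen_univ := fun _ _ => ⟨1, one_pos, 0, Set.subset_univ _⟩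
  isOpen_inter := by
    rintro U V hU hV x ⟨hxU, hxV⟩
    obtain ⟨ε, hε, T, h⟩ := hU x hxU
    obtain ⟨ε', hε', T', h'⟩ := hV x hxV
    exact ⟨min ε ε', lt_min hε hε', max T T', Set.subset_inter
      ((j1Nhd_mono x (min_le_left _ _) (le_max_left _ _)).trans h)
      ((j1Nhd_mono x (min_le_right _ _) (le_max_right _ _)).trans h')⟩
  isOpen_sUnion := by
    rintro S hS x ⟨U, hU, hxU⟩
    obtain ⟨ε, hε, T, h⟩ := hS U hU x hxU
    exact ⟨ε, hε, T, h.trans (Set.subset_sUnion_of_mem hU)⟩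

/-- The constant function `c` as an element of `D[0,∞)`. -/
def Cadlag.const (c : ℝ) : Cadlag where
  toFun := fun _ => c
  right_cont := fun _ => continuousWithinAt_const
  left_lim := fun _ => ⟨c, tendsto_const_nhds⟩

end DynComplex

end

noncomputable section

namespace DynComplex

/-! ### Paths of the on/off processes -/

/-! At a fixed time every potential `i`-simplex is on with probability `p_i`, so the expected number
`f_j` of `j`-faces is of order `n^{τ_j}`, and for `j = k` it is `n^{τ_k}/(k+1)!` to first order.
Since `τ_{j+1} - τ_j = 1 - ψ_{j+1}` and `ψ` is nondecreasing, `τ_j` increases up to `j = k` and then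
decreases at least linearly: dimension `k` dominates strictly. The Euler characteristic is `(-1)^k
f_k` plus other face counts, and `f_k - f_{k-1} - f_{k+1} ≤ β_k ≤ f_k` (`le_betti`, `betti_le`). It
remains to prove, uniformly on bounded time intervals, that `f_k / n^{τ_k}` tends to `1/(k+1)!`,
that the other face counts are `o(n^{τ_k})`, and that faces of some fixed high dimension eventually
disappear.

Concentration: counts of events that depend only on the simplices inside one vertex set have
covariances only from pairs sharing at least two vertices. A shared `l`-face contributes order
`n^{2τ_j - τ_l}`, at most `n^{2τ_k - τ_1}` (`variance_count_le`). As `τ_1 > 1`, Chebyshev and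
Borel–Cantelli give almost sure convergence whatever the joint law over `n`
(`ae_tendsto_of_variance_le`).

Uniformity in time: a simplex that is on at some time up to `T` has an on-interval starting by `T`,
which has probability at most a constant times `p_i`, because states are independent of renewal
times (`measureReal_onBy_le`). This dominates all face counts on `[0,T]` at once. For `k`-faces a
fixed grid is used: between grid points the count changes by at most the number of sets containing a
switching simplex, and a switch in an interval of length `d` has probability at most `g(d) p_i` with
`g(d) → 0` (`measureReal_switchIn_le`, `tendsto_switchBound`). Uniform convergence to a constant
gives `J₁` convergence with the identity as time change. -/

/-- The state is on at time `t`. -/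
def OnAt (x : RenewalVar → ℝ) (t : ℝ) : Prop :=
  ∃ j, x (.state j) = 1 ∧ renewalTime x j ≤ t ∧ t < renewalTime x (j + 1)

/-- Some renewal interval that starts before time `T` carries the state on. -/
def OnBy (x : RenewalVar → ℝ) (T : ℝ) : Prop :=
  ∃ j, x (.state j) = 1 ∧ renewalTime x j ≤ T

/-- Some renewal interval with an endpoint in `(s, t]` carries the state on. -/
def SwitchIn (x : RenewalVar → ℝ) (s t : ℝ) : Prop :=
  ∃ j, x (.state j) = 1 ∧
    (renewalTime x j ∈ Set.Ioc s t ∨ renewalTime x (j + 1) ∈ Set.Ioc s t)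

/-- The renewal times increase strictly to infinity and the states are zero or one. -/
structure GoodPath (x : RenewalVar → ℝ) : Prop where
  state : ∀ j, x (.state j) = 0 ∨ x (.state j) = 1
  mono : StrictMono (renewalTime x)
  tendsto : Tendsto (renewalTime x) atTop atTop

theorem OnAt.onBy {x : RenewalVar → ℝ} {t T : ℝ} (h : OnAt x t) (hT : t ≤ T) : OnBy x T := by
  obtain ⟨j, h1, h2, -⟩ := h
  exact ⟨j, h1, h2.trans hT⟩

namespace GoodPath

variable {x : RenewalVar → ℝ}

theorem exists_index (hx : GoodPath x) {t : ℝ} (ht : 0 ≤ t) :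
    ∃ j, renewalTime x j ≤ t ∧ t < renewalTime x (j + 1) := by
  classical
  have hex : ∃ m, t < renewalTime x m := (hx.tendsto.eventually_gt_atTop t).exists
  have h0 : Nat.find hex ≠ 0 := by
    intro h
    have := Nat.find_spec hex
    rw [h] at this
    simp only [renewalTime] at this
    linarith
  obtain ⟨j, hj⟩ := Nat.exists_eq_succ_of_ne_zero h0
  refine ⟨j, not_lt.1 (Nat.find_min hex (by omega)), ?_⟩
  have := Nat.find_spec hex
  rwa [hj] at this

theorem onOff_eq (hx : GoodPath x) {t : ℝ≥0} {j : ℕ} (h1 : renewalTime x j ≤ t)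
    (h2 : (t : ℝ) < renewalTime x (j + 1)) : onOff x t = x (.state j) := by
  unfold onOff
  rw [tsum_eq_single j, Set.indicator_of_mem (show (t : ℝ) ∈ Set.Ico _ _ from ⟨h1, h2⟩)]
  intro i hi
  refine Set.indicator_of_notMem ?_ _
  rintro ⟨h3, h4⟩
  rcases lt_or_gt_of_ne hi with h | h
  · have := hx.mono.monotone (Nat.succ_le_of_lt h)
    simp only [Nat.succ_eq_add_one] at this
    linarith
  · have := hx.mono.monotone (Nat.succ_le_of_lt h)
    simp only [Nat.succ_eq_add_one] at this
    linarith

theorem onOff_eq_one_iff (hx : GoodPath x) (t : ℝ≥0) : onOff x t = 1 ↔ OnAt x t := by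
  constructor
  · intro h
    obtain ⟨j, h1, h2⟩ := hx.exists_index t.2
    exact ⟨j, by rw [← hx.onOff_eq h1 h2, h], h1, h2⟩
  · rintro ⟨j, h, h1, h2⟩
    rw [hx.onOff_eq h1 h2, h]

theorem switchIn (hx : GoodPath x) {s u : ℝ≥0} {t : ℝ} (hsu : s ≤ u) (hut : (u : ℝ) ≤ t)
    (h : ¬ (onOff x u = 1 ↔ onOff x s = 1)) : SwitchIn x s t := by
  obtain ⟨i, hi1, hi2⟩ := hx.exists_index s.2
  obtain ⟨j, hj1, hj2⟩ := hx.exists_index u.2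
  have hsu' : (s : ℝ) ≤ u := by exact_mod_cast hsu
  rw [hx.onOff_eq hi1 hi2, hx.onOff_eq hj1 hj2] at h
  have hne : i ≠ j := by rintro rfl; exact h Iff.rfl
  have hlt : i < j := by
    by_contra hle
    have h3 : j + 1 ≤ i := by omega
    have := hx.mono.monotone h3
    change renewalTime x i ≤ (s : ℝ) at hi1
    change (u : ℝ) < renewalTime x (j + 1) at hj2
    linarith
  have h4 := hx.mono.monotone (Nat.succ_le_of_lt hlt)
  simp only [Nat.succ_eq_add_one] at h4
  change (s : ℝ) < renewalTime x (i + 1) at hi2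
  change renewalTime x j ≤ (u : ℝ) at hj1
  -- Exactly one of the two intervals is on. The earlier one ends, and the later one starts, inside
  -- `(s, u]`.
  by_cases h5 : x (.state i) = 1
  · exact ⟨i, h5, Or.inr ⟨hi2, by linarith⟩⟩
  · have h6 : x (.state j) = 1 := by tauto
    exact ⟨j, h6, Or.inl ⟨by linarith, by linarith⟩⟩

theorem onOff_eventuallyEq_right (hx : GoodPath x) (t : ℝ≥0) :
    ∀ᶠ u in 𝓝[≥] t, onOff x u = onOff x t := by
  obtain ⟨j, h1, h2⟩ := hx.exists_index t.2
  have h3 : ∀ᶠ u : ℝ≥0 in 𝓝[≥] t, (u : ℝ) < renewalTime x (j + 1) :=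
    (NNReal.continuous_coe.tendsto t).mono_left nhdsWithin_le_nhds |>.eventually
      (eventually_lt_nhds h2)
  filter_upwards [h3, self_mem_nhdsWithin] with u hu hu'
  have : (t : ℝ) ≤ u := by exact_mod_cast hu'
  rw [hx.onOff_eq h1 h2, hx.onOff_eq (h1.trans this) hu]

theorem exists_onOff_eventuallyEq_left (hx : GoodPath x) (t : ℝ≥0) :
    ∃ c, ∀ᶠ u in 𝓝[<] t, onOff x u = c := by
  obtain ⟨j, h1, h2⟩ := hx.exists_index t.2
  change renewalTime x j ≤ (t : ℝ) at h1
  change (t : ℝ) < renewalTime x (j + 1) at h2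
  have hlow : ∀ i, renewalTime x i < t → ∀ᶠ u : ℝ≥0 in 𝓝[<] t, renewalTime x i < u := fun i hi =>
    (NNReal.continuous_coe.tendsto t).mono_left nhdsWithin_le_nhds |>.eventually
      (eventually_gt_nhds hi)
  rcases h1.lt_or_eq with h1 | h1
  · refine ⟨x (.state j), ?_⟩
    filter_upwards [hlow j h1, self_mem_nhdsWithin] with u hu hu'
    have : (u : ℝ) < t := by exact_mod_cast hu'
    exact hx.onOff_eq hu.le (this.trans h2)
  -- At a renewal time the left limit is the state of the preceding interval. At `t = 0` nothing
  -- lies to the left, so the value `0` is arbitrary.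
  · rcases j with _ | j
    · have ht : t = 0 := by
        have : (t : ℝ) = 0 := by rw [← h1]; rfl
        exact_mod_cast this
      refine ⟨0, ?_⟩
      filter_upwards [self_mem_nhdsWithin] with u hu
      rw [ht] at hu
      exact absurd (Set.mem_Iio.1 hu) not_lt_zero
    · refine ⟨x (.state j), ?_⟩
      filter_upwards [hlow j (h1 ▸ hx.mono (Nat.lt_succ_self j)), self_mem_nhdsWithin] with u hu hu'
      have : (u : ℝ) < t := by exact_mod_cast hu'
      exact hx.onOff_eq hu.le (this.trans_eq h1.symm)

end GoodPath

/-! ### Paths of functionals of the complex in `D[0,∞)` -/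

/-- The complex whose positive-dimensional faces are the sets all of whose subsets have value `1`. -/
def complexOf {n : ℕ} (g : Simplex n → ℝ) : AbstractSimplicialComplex (Fin n) where
  faces := {A | A.Nonempty ∧ ∀ B : Simplex n, B.1 ⊆ A → g B = 1}
  isRelLowerSet_faces := fun _ hA =>
    ⟨hA.1, fun _ hBA hB => ⟨hB, fun C hC => hA.2 C (hC.trans hBA)⟩⟩
  singleton_mem := by
    intro v
    refine ⟨Finset.singleton_nonempty v, fun B hB => ?_⟩
    have h1 := Finset.card_le_card hB
    have h2 := B.2
    simp at h1
    omega

instance (n : ℕ) : Fintype (Simplex n) :=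
  inferInstanceAs (Fintype {A : Finset (Fin n) // 2 ≤ A.card})

instance (n : ℕ) : DecidableEq (Simplex n) :=
  inferInstanceAs (DecidableEq {A : Finset (Fin n) // 2 ≤ A.card})

/-- Any numerical function of the complex has right continuous paths with left limits. -/
def cadlagOfComplex {n : ℕ} {x : Simplex n → RenewalVar → ℝ} (hx : ∀ B, GoodPath (x B))
    (F : AbstractSimplicialComplex (Fin n) → ℝ) : Cadlag where
  toFun t := F (complexAt x t)
  right_cont t := by
    -- There are finitely many simplices on `[n]`, so all on/off values are constant on a common
    -- one-sided neighbourhood.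
    have h : ∀ᶠ u in 𝓝[≥] t, ∀ B, onOff (x B) u = onOff (x B) t :=
      eventually_all.2 fun B => (hx B).onOff_eventuallyEq_right t
    refine tendsto_const_nhds.congr' ?_
    filter_upwards [h] with u hu
    change F (complexOf fun B => onOff (x B) t) = F (complexOf fun B => onOff (x B) u)
    simp only [hu]
  left_lim t := by
    choose c hc using fun B => (hx B).exists_onOff_eventuallyEq_left t
    refine ⟨F (complexOf c), tendsto_const_nhds.congr' ?_⟩
    filter_upwards [eventually_all.2 hc] with u hu
    change F (complexOf c) = F (complexOf fun B => onOff (x B) u)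
    simp only [hu]

/-- Uniform convergence on compact sets to a constant implies convergence in `D[0,∞)`. -/
theorem Cadlag.tendsto_const {Y : ℕ → Cadlag} {c : ℝ}
    (h : ∀ ε > 0, ∀ T : ℝ≥0, ∀ᶠ n in atTop, ∀ t ≤ T, |(Y n).toFun t - c| ≤ ε) :
    Tendsto Y atTop (𝓝 (Cadlag.const c)) := by
  rw [tendsto_nhds]
  intro U hU hc
  obtain ⟨ε, hε, T, hs⟩ := hU _ hc
  filter_upwards [h ε hε T] with n hn
  exact hs ⟨OrderIso.refl _, fun t => by simpa using hε.le, fun t ht => hn t ht⟩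

/-! ### Face counts, Betti numbers and the Euler characteristic -/

section Homology

variable {n : ℕ} (X : AbstractSimplicialComplex (Fin n)) (K : Type*) [Field K]

theorem finrank_chains (m : ℕ) : Module.finrank K (chains K X (m + 1)) = faceCount X m := by
  classical
  have hset : {A : Finset (Fin n) | (A = ∅ ∨ A ∈ X.faces) ∧ A.card = m + 1} =
      {A : Finset (Fin n) | A ∈ X.faces ∧ A.card = m + 1} := by
    ext A
    constructor
    · rintro ⟨rfl | h, h2⟩
      · simp at h2
      · exact ⟨h, h2⟩
    · exact fun h => ⟨Or.inr h.1, h.2⟩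
  unfold chains faceCount
  rw [hset, LinearEquiv.finrank_eq (Finsupp.supportedEquivFinsupp _)]
  have : Fintype {A : Finset (Fin n) | A ∈ X.faces ∧ A.card = m + 1} := Fintype.ofFinite _
  rw [Module.finrank_finsupp_self, ← Nat.card_eq_fintype_card, Nat.card_coe_set_eq]

theorem boundary_mem_chains (m : ℕ) {c : Finset (Fin n) →₀ K} (hc : c ∈ chains K X (m + 1)) :
    boundary K n c ∈ chains K X m := by
  unfold boundary
  rw [Finsupp.linearCombination_apply]
  refine Submodule.sum_mem _ fun A hA => Submodule.smul_mem _ _ (Submodule.sum_mem _ fun v hv => ?_)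
  obtain ⟨h1, h2⟩ := (Finsupp.mem_supported _ _).1 hc hA
  refine Finsupp.single_mem_supported K _ ⟨?_, ?_⟩
  · rcases (A.erase v).eq_empty_or_nonempty with h | h
    · exact Or.inl h
    · rcases h1 with rfl | h1
      · simp at hv
      · exact Or.inr ((X.isRelLowerSet_faces h1).2 (Finset.erase_subset v A) h)
  · rw [Finset.card_erase_of_mem hv, h2]; rfl

theorem betti_le (j : ℕ) : betti K X j ≤ faceCount X j := by
  rw [← finrank_chains X K j]
  exact (Submodule.finrank_quotient_le _).trans (Submodule.finrank_mono inf_le_left)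

/-- Rank–nullity: the boundary map on `(j+1)`-chains has rank at most `f_j`, which leaves a cycle
space of dimension at least `f_{j+1} - f_j`; the boundaries remove at most `f_{j+2}` from it. -/
theorem le_betti (j : ℕ) :
    faceCount X (j + 1) ≤ betti K X (j + 1) + faceCount X j + faceCount X (j + 2) := by
  have h1 := Submodule.finrank_quotient_add_finrank (R := K) (M := cycles K X (j + 1))
    ((boundaries K X (j + 1)).submoduleOf (cycles K X (j + 1)))
  have h2 : Module.finrank K ((boundaries K X (j + 1)).submoduleOf (cycles K X (j + 1))) ≤
      faceCount X (j + 2) := by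
    rw [← finrank_chains X K (j + 2)]
    refine le_trans ?_ (Submodule.finrank_map_le (boundary K n) (chains K X (j + 2 + 1)))
    exact LinearMap.finrank_le_finrank_of_injective
      (f := ((cycles K X (j + 1)).subtype.domRestrict _).codRestrict
        (boundaries K X (j + 1)) fun x => x.2)
      (fun x y h => Subtype.ext (Subtype.ext (congrArg (Submodule.subtype _) h :)))
  let d : chains K X (j + 2) →ₗ[K] chains K X (j + 1) :=
    ((boundary K n).domRestrict _).codRestrict _
      fun c => boundary_mem_chains X K (j + 1) c.2
  have h3 := LinearMap.finrank_range_add_finrank_ker (K := K) (V := chains K X (j + 2))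
    (V₂ := chains K X (j + 1)) d
  have h4 : Module.finrank K (LinearMap.range d) ≤ faceCount X j := by
    rw [← finrank_chains X K j]
    exact Submodule.finrank_le _
  have h5 : Module.finrank K (LinearMap.ker d) ≤ Module.finrank K (cycles K X (j + 1)) := by
    refine LinearMap.finrank_le_finrank_of_injective
      (f := ((chains K X (j + 2)).subtype.domRestrict (LinearMap.ker d)).codRestrict
        (cycles K X (j + 1)) fun x => ⟨x.1.2, ?_⟩)
      (fun x y h => Subtype.ext (Subtype.ext (congrArg (Submodule.subtype _) h :)))
    have := x.2
    rw [LinearMap.mem_ker] at this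
    exact congrArg Subtype.val this
  rw [finrank_chains X K (j + 1)] at h3
  unfold betti quotientDim
  omega

theorem faceCount_eq_zero_of_le {i j : ℕ} (hij : i ≤ j) (h : faceCount X i = 0) :
    faceCount X j = 0 := by
  unfold faceCount at *
  rw [Set.ncard_eq_zero (Set.toFinite _)] at *
  rw [Set.eq_empty_iff_forall_notMem] at *
  rintro A ⟨hA, hc⟩
  obtain ⟨B, hB, hBc⟩ := Finset.exists_subset_card_eq (s := A) (n := i + 1) (by omega)
  exact h B ⟨(X.isRelLowerSet_faces hA).2 hB (Finset.card_pos.1 (by omega)), hBc⟩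

/-- An empty dimension `J` empties all higher ones, so the number of error terms does not grow with
`n`. This matters because the other face counts are controlled one dimension at a time. -/
theorem abs_eulerChar_sub_le {k J : ℕ} (hk : k < n) (hJ : faceCount X J = 0) :
    |(eulerChar X : ℝ) - (-1) ^ k * faceCount X k| ≤
      ∑ j ∈ (Finset.range J).erase k, (faceCount X j : ℝ) := by
  have h1 : (eulerChar X : ℝ) - (-1) ^ k * faceCount X k =
      ∑ j ∈ (Finset.range n).erase k, (-1) ^ j * (faceCount X j : ℝ) := by
    unfold eulerChar
    push_cast
    rw [← Finset.sum_erase_add _ _ (Finset.mem_range.2 hk)]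
    ring
  rw [h1]
  refine (Finset.abs_sum_le_sum_abs _ _).trans ?_
  have h2 : ∀ j, |(-1) ^ j * (faceCount X j : ℝ)| = faceCount X j := fun j => by
    rw [abs_mul, abs_pow]; simp
  simp only [h2]
  rw [← Finset.sum_filter_add_sum_filter_not _ (fun j => j < J)]
  have h3 : ∑ j ∈ ((Finset.range n).erase k).filter (fun j => ¬ j < J), (faceCount X j : ℝ) = 0 := by
    refine Finset.sum_eq_zero fun j hj => ?_
    rw [faceCount_eq_zero_of_le X (not_lt.1 (Finset.mem_filter.1 hj).2) hJ, Nat.cast_zero]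
  rw [h3, add_zero]
  refine Finset.sum_le_sum_of_subset_of_nonneg (fun j hj => ?_) fun _ _ _ => Nat.cast_nonneg _
  simp only [Finset.mem_filter, Finset.mem_erase, Finset.mem_range] at *
  exact ⟨hj.1.1, hj.2⟩

end Homology

/-! ### Real exponents -/

/-- The exponents cut off at `2`, with value `0` at the unused index `0`. -/
def cutExp (α : ℕ → ℝ≥0∞) (i : ℕ) : ℝ := if i = 0 then 0 else (min (α i) 2).toReal

/-- The real analogue of `psi`. -/
def psiReal (b : ℕ → ℝ) (l : ℕ) : ℝ := ∑ i ∈ Finset.range (l + 1), (l.choose i : ℝ) * b i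

/-- The total exponent of the faces of a set with `m` vertices. -/
def faceExp (b : ℕ → ℝ) (m : ℕ) : ℝ := ∑ l ∈ Finset.range m, psiReal b l

/-- The real analogue of `tau`. -/
def tauReal (b : ℕ → ℝ) (j : ℕ) : ℝ := (j + 1 : ℕ) - faceExp b (j + 1)

theorem cutExp_zero (α : ℕ → ℝ≥0∞) : cutExp α 0 = 0 := if_pos rfl

theorem cutExp_nonneg (α : ℕ → ℝ≥0∞) (i : ℕ) : 0 ≤ cutExp α i := by
  unfold cutExp
  split_ifs
  · exact le_rfl
  · exact ENNReal.toReal_nonneg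

/-- Adding a vertex to `A` creates one new subset `insert v B` of dimension `B.card` for each `B ⊆
A`, which adds `psiReal b A.card`. By truncated subtraction the empty set and the vertices both get
index `0`, where `b` vanishes. -/
theorem sum_powerset_eq_faceExp {ι : Type*} [DecidableEq ι] {b : ℕ → ℝ} (hb : b 0 = 0)
    (A : Finset ι) : ∑ B ∈ A.powerset, b (B.card - 1) = faceExp b A.card := by
  induction A using Finset.induction_on with
  | empty => simp [faceExp, hb]
  | insert v A hv ih =>
    rw [Finset.sum_powerset_insert hv, ih, Finset.card_insert_of_notMem hv]
    unfold faceExp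
    rw [Finset.sum_range_succ]
    congr 1
    have : ∀ B ∈ A.powerset, b ((insert v B).card - 1) = b B.card := fun B hB => by
      rw [Finset.card_insert_of_notMem fun h => hv (Finset.mem_powerset.1 hB h)]; rfl
    rw [Finset.sum_congr rfl this, Finset.sum_powerset_apply_card]
    simp [psiReal]

theorem faceProb_nonneg (n : ℕ) (a : ℝ≥0∞) : 0 ≤ faceProb n a := by
  unfold faceProb
  split_ifs <;> positivity

/-- Lowering an exponent only raises the power. Upper bounds are all that the error terms need;
equality, from `faceProb_eq_rpow`, is used only for the mean number of `k`-faces. -/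
theorem faceProb_le_rpow (α : ℕ → ℝ≥0∞) {n i : ℕ} (hn : 1 ≤ n) (hi : 1 ≤ i) :
    faceProb n (α i) ≤ (n : ℝ) ^ (-cutExp α i) := by
  unfold faceProb cutExp
  rw [if_neg (by omega : i ≠ 0)]
  split_ifs with h
  · positivity
  · refine Real.rpow_le_rpow_of_exponent_le (by exact_mod_cast hn) (neg_le_neg ?_)
    exact ENNReal.toReal_mono h (min_le_left _ _)

theorem faceProb_eq_rpow (α : ℕ → ℝ≥0∞) {n i : ℕ} (hi : 1 ≤ i) (h : α i ≤ 2) :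
    faceProb n (α i) = (n : ℝ) ^ (-cutExp α i) := by
  unfold faceProb cutExp
  rw [if_neg (by omega : i ≠ 0), min_eq_left h, if_neg]
  rintro h'
  simp [h'] at h

theorem le_psi (α : ℕ → ℝ≥0∞) {i j : ℕ} (hi : 1 ≤ i) (hij : i ≤ j) : α i ≤ psi α j := by
  refine le_trans ?_ (Finset.single_le_sum (f := fun i => (j.choose i : ℝ≥0∞) * α i)
    (fun _ _ => zero_le) (Finset.mem_Icc.2 ⟨hi, hij⟩))
  have : (1 : ℝ≥0∞) ≤ j.choose i := by exact_mod_cast Nat.choose_pos hij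
  exact le_mul_of_one_le_left zero_le this

theorem psiReal_cutExp (α : ℕ → ℝ≥0∞) (l : ℕ) :
    psiReal (cutExp α) l = (∑ i ∈ Finset.Icc 1 l, (l.choose i : ℝ≥0∞) * min (α i) 2).toReal := by
  rw [ENNReal.toReal_sum fun _ _ => ENNReal.mul_ne_top (ENNReal.natCast_ne_top _)
    (ne_top_of_le_ne_top ENNReal.ofNat_ne_top (min_le_right _ _))]
  unfold psiReal
  rw [Finset.sum_range_eq_add_Ico _ (Nat.succ_pos l), cutExp_zero, mul_zero, zero_add]
  refine Finset.sum_congr rfl fun i hi => ?_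
  have : i ≠ 0 := by have := (Finset.mem_Ico.1 hi).1; omega
  rw [ENNReal.toReal_mul, ENNReal.toReal_natCast, cutExp, if_neg this]

theorem psi_cut_ne_top (α : ℕ → ℝ≥0∞) (l : ℕ) :
    ∑ i ∈ Finset.Icc 1 l, (l.choose i : ℝ≥0∞) * min (α i) 2 ≠ ∞ :=
  ENNReal.sum_ne_top.2 fun _ _ => ENNReal.mul_ne_top (ENNReal.natCast_ne_top _)
    (ne_top_of_le_ne_top ENNReal.ofNat_ne_top (min_le_right _ _))

/-- Combined with `tauReal_succ`, this makes `tauReal` unimodal with its strict maximum at the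
critical index. -/
theorem psiReal_mono {b : ℕ → ℝ} (hb : ∀ i, 0 ≤ b i) : Monotone (psiReal b) := by
  intro l m hlm
  unfold psiReal
  refine le_trans (Finset.sum_le_sum (g := fun i => (m.choose i : ℝ) * b i) fun i _ => ?_)
    (Finset.sum_le_sum_of_subset_of_nonneg (Finset.range_subset_range.2 (by omega))
      fun i _ _ => mul_nonneg (Nat.cast_nonneg _) (hb i))
  exact mul_le_mul_of_nonneg_right (by exact_mod_cast Nat.choose_le_choose i hlm) (hb i)

theorem tauReal_succ (b : ℕ → ℝ) (j : ℕ) :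
    tauReal b (j + 1) = tauReal b j + (1 - psiReal b (j + 1)) := by
  unfold tauReal faceExp
  rw [Finset.sum_range_succ _ (j + 1)]
  push_cast
  ring

theorem tauReal_zero {b : ℕ → ℝ} (hb : b 0 = 0) : tauReal b 0 = 1 := by
  simp [tauReal, faceExp, psiReal, hb]

/-- Nonnegative real exponents in the critical region. -/
structure Critical (b : ℕ → ℝ) (k : ℕ) : Prop where
  zero : b 0 = 0
  nonneg : ∀ i, 0 ≤ b i
  pos : 1 ≤ k
  lt_one : psiReal b k < 1
  one_lt : 1 < psiReal b (k + 1)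

namespace Critical

variable {b : ℕ → ℝ} {k : ℕ}

theorem tauReal_lt_succ (h : Critical b k) {j : ℕ} (hj : j < k) :
    tauReal b j < tauReal b (j + 1) := by
  rw [tauReal_succ]
  have := psiReal_mono h.nonneg (Nat.succ_le_of_lt hj)
  simp only [Nat.succ_eq_add_one] at this
  linarith [h.lt_one]

theorem tauReal_mono (h : Critical b k) {i j : ℕ} (hij : i ≤ j) (hj : j ≤ k) :
    tauReal b i ≤ tauReal b j := by
  induction j, hij using Nat.le_induction with
  | base => exact le_rfl
  | succ j _ ih => exact (ih (by omega)).trans (h.tauReal_lt_succ (by omega)).le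

/-- Past `k` every step loses at least the fixed amount `psiReal b (k + 1) - 1`, so `tauReal` tends
to `-∞`. -/
theorem tauReal_add_le (h : Critical b k) {j : ℕ} (hj : k ≤ j) (m : ℕ) :
    tauReal b (j + m) ≤ tauReal b j - m * (psiReal b (k + 1) - 1) := by
  induction m with
  | zero => simp
  | succ m ih =>
    rw [← add_assoc, tauReal_succ]
    have := psiReal_mono h.nonneg (show k + 1 ≤ j + m + 1 by omega)
    push_cast
    linarith

theorem tauReal_anti (h : Critical b k) {i j : ℕ} (hi : k ≤ i) (hij : i ≤ j) :
    tauReal b j ≤ tauReal b i := by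
  obtain ⟨m, rfl⟩ := Nat.exists_eq_add_of_le hij
  have := h.tauReal_add_le hi m
  have h2 : 0 ≤ (m : ℝ) * (psiReal b (k + 1) - 1) :=
    mul_nonneg (Nat.cast_nonneg _) (by linarith [h.one_lt])
  linarith

theorem tauReal_lt (h : Critical b k) {j : ℕ} (hj : j ≠ k) : tauReal b j < tauReal b k := by
  rcases lt_or_gt_of_ne hj with hj | hj
  · exact (h.tauReal_lt_succ hj).trans_le (h.tauReal_mono hj le_rfl)
  · refine (h.tauReal_anti (Nat.le_succ k) hj).trans_lt ?_
    have := h.tauReal_add_le le_rfl 1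
    have h2 := h.one_lt
    push_cast at this
    simp only [Nat.succ_eq_add_one]
    linarith

theorem tauReal_le (h : Critical b k) (j : ℕ) : tauReal b j ≤ tauReal b k := by
  rcases eq_or_ne j k with rfl | hj
  · exact le_rfl
  · exact (h.tauReal_lt hj).le

/-- This strict inequality makes the Chebyshev bounds summable in `n`. -/
theorem one_lt_tauReal_one (h : Critical b k) : 1 < tauReal b 1 := by
  rw [← tauReal_zero h.zero]
  exact h.tauReal_lt_succ h.pos

theorem exists_tauReal_le (h : Critical b k) (c : ℝ) : ∃ J, tauReal b J ≤ c := by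
  have hpos : 0 < psiReal b (k + 1) - 1 := by linarith [h.one_lt]
  obtain ⟨m, hm⟩ := exists_nat_ge ((tauReal b k - c) / (psiReal b (k + 1) - 1))
  rw [div_le_iff₀ hpos] at hm
  exact ⟨k + m, by linarith [h.tauReal_add_le le_rfl m]⟩

/-- The exponent of the contribution to the variance of pairs that share an `l`-face. -/
theorem variance_exponent_le (h : Critical b k) {l j : ℕ} (hl : 1 ≤ l) (hlj : l ≤ j) :
    2 * tauReal b j - tauReal b l ≤ 2 * tauReal b k - tauReal b 1 := by
  have hj := h.tauReal_le j
  -- For `l ≤ k`, use `τ_1 ≤ τ_l` and `τ_j ≤ τ_k`. For `l ≥ k`, `τ_j ≤ τ_l` bounds the left side by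
  -- `τ_j ≤ τ_k`, and `τ_1 ≤ τ_k`.
  rcases le_total l k with hk | hk
  · have := h.tauReal_mono hl hk
    linarith
  · have h1 := h.tauReal_anti hk hlj
    have h2 := h.tauReal_mono (le_refl 1 |>.trans h.pos) le_rfl
    linarith

end Critical

/-! ### From exponents in `[0,∞]` to real exponents -/

section

variable {α : ℕ → ℝ≥0∞} {k : ℕ}

theorem le_two_of_mem_critRegion (hα : α ∈ critRegion k) {i : ℕ} (hi : 1 ≤ i) (hik : i ≤ k) :
    α i ≤ 2 :=
  ((le_psi α hi hik).trans hα.1.le).trans one_le_two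

/-- The infimum of the empty set would be `0`, but if all exponents of positive index vanished, so
would `psi α (k + 1)`, which exceeds `1`. -/
theorem one_le_lowestDim (hα : α ∈ critRegion k) : 1 ≤ lowestDim α := by
  have hne : {i | 1 ≤ i ∧ 0 < α i}.Nonempty := by
    by_contra hne
    rw [Set.not_nonempty_iff_eq_empty] at hne
    have h0 : psi α (k + 1) = 0 := by
      refine Finset.sum_eq_zero fun i hi => ?_
      have : α i = 0 := by
        by_contra hi'
        have : i ∈ ({i | 1 ≤ i ∧ 0 < α i} : Set ℕ) :=
          ⟨(Finset.mem_Icc.1 hi).1, pos_iff_ne_zero.2 hi'⟩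
        rw [hne] at this
        exact this
      rw [this, mul_zero]
    have := hα.2
    rw [h0] at this
    exact absurd this not_lt_zero
  exact (Nat.sInf_mem hne).1

theorem psiReal_cutExp_eq (hα : α ∈ critRegion k) {l : ℕ} (hl : l ≤ k) :
    psiReal (cutExp α) l = (psi α l).toReal := by
  rw [psiReal_cutExp]
  congr 1
  refine Finset.sum_congr rfl fun i hi => ?_
  obtain ⟨h1, h2⟩ := Finset.mem_Icc.1 hi
  rw [min_eq_left (le_two_of_mem_critRegion hα h1 (h2.trans hl))]

theorem psi_ne_top (hα : α ∈ critRegion k) {l : ℕ} (hl : l ≤ k) : psi α l ≠ ∞ := by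
  refine ENNReal.sum_ne_top.2 fun i hi => ENNReal.mul_ne_top (ENNReal.natCast_ne_top _) ?_
  obtain ⟨h1, h2⟩ := Finset.mem_Icc.1 hi
  exact ne_top_of_le_ne_top ENNReal.ofNat_ne_top (le_two_of_mem_critRegion hα h1 (h2.trans hl))

/-- Exponents of index up to `k` lie below `1` and are not cut. If one of index `k + 1` is cut, its
value `2` alone keeps `ψ_{k+1}` above `1`. -/
theorem critical_cutExp (hα : α ∈ critRegion k) (hk : 1 ≤ k) : Critical (cutExp α) k where
  zero := cutExp_zero α
  nonneg := cutExp_nonneg α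
  pos := hk
  lt_one := by
    rw [psiReal_cutExp_eq hα le_rfl]
    have := (ENNReal.toReal_lt_toReal (psi_ne_top hα le_rfl) ENNReal.one_ne_top).2 hα.1
    simpa using this
  one_lt := by
    rw [psiReal_cutExp]
    have : 1 < ∑ i ∈ Finset.Icc 1 (k + 1), ((k + 1).choose i : ℝ≥0∞) * min (α i) 2 := by
      by_cases h : ∀ i ∈ Finset.Icc 1 (k + 1), α i ≤ 2
      · refine hα.2.trans_eq (Finset.sum_congr rfl fun i hi => ?_)
        rw [min_eq_left (h i hi)]
      · push Not at h
        obtain ⟨i, hi, h2⟩ := h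
        have h3 := le_psi (fun i => min (α i) 2) (Finset.mem_Icc.1 hi).1 (Finset.mem_Icc.1 hi).2
        simp only [min_eq_right h2.le] at h3
        exact ENNReal.one_lt_two.trans_le h3
    have := (ENNReal.toReal_lt_toReal ENNReal.one_ne_top (psi_cut_ne_top α (k + 1))).2 this
    simpa using this

theorem toReal_tau (hα : α ∈ critRegion k) : (tau α k).toReal = tauReal (cutExp α) k := by
  have hne : ∑ i ∈ Finset.Icc 1 k, psi α i ≠ ∞ :=
    ENNReal.sum_ne_top.2 fun i hi => psi_ne_top hα (Finset.mem_Icc.1 hi).2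
  unfold tau tauReal faceExp
  rw [EReal.toReal_sub (EReal.natCast_ne_top _) (EReal.natCast_ne_bot _)
    (by simpa using hne) (EReal.coe_ennreal_ne_bot _), EReal.toReal_coe_ennreal,
    ENNReal.toReal_sum fun i hi => psi_ne_top hα (Finset.mem_Icc.1 hi).2,
    Finset.sum_range_eq_add_Ico _ (Nat.succ_pos k)]
  have h0 : psiReal (cutExp α) 0 = 0 := by simp [psiReal, cutExp_zero]
  rw [h0, zero_add]
  congr 1
  exact Finset.sum_congr rfl fun i hi =>
    (psiReal_cutExp_eq hα (Finset.mem_Icc.1 hi).2).symm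

end

/-! ### Probabilities for a single on/off process -/

theorem measurable_renewalTime (j : ℕ) : Measurable fun x : RenewalVar → ℝ => renewalTime x j := by
  cases j with
  | zero => exact measurable_const
  | succ j => unfold renewalTime; fun_prop

theorem measurableSet_onAt (t : ℝ) : MeasurableSet {x : RenewalVar → ℝ | OnAt x t} := by
  simp only [OnAt, Set.ofPred_exists]
  refine MeasurableSet.iUnion fun j => ?_
  refine (measurableSet_eq_fun (measurable_pi_apply _) measurable_const).inter
    ((measurableSet_le (measurable_renewalTime j) measurable_const).inter
      (measurableSet_lt measurable_const (measurable_renewalTime (j + 1))))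

theorem measurableSet_onBy (t : ℝ) : MeasurableSet {x : RenewalVar → ℝ | OnBy x t} := by
  simp only [OnBy, Set.ofPred_exists]
  refine MeasurableSet.iUnion fun j => ?_
  exact (measurableSet_eq_fun (measurable_pi_apply _) measurable_const).inter
    (measurableSet_le (measurable_renewalTime j) measurable_const)

theorem measurableSet_switchIn (s t : ℝ) :
    MeasurableSet {x : RenewalVar → ℝ | SwitchIn x s t} := by
  simp only [SwitchIn, Set.ofPred_exists]
  refine MeasurableSet.iUnion fun j => ?_
  exact (measurableSet_eq_fun (measurable_pi_apply _) measurable_const).inter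
    ((measurable_renewalTime j measurableSet_Ioc).union
      (measurable_renewalTime (j + 1) measurableSet_Ioc))

/-- A countable union bound for real-valued probabilities. -/
theorem measureReal_le_tsum {Ω : Type*} [MeasurableSpace Ω] {P : Measure Ω} [IsFiniteMeasure P]
    {E : Set Ω} {F : ℕ → Set Ω} {u : ℕ → ℝ} (hE : E ⊆ ⋃ j, F j) (hF : ∀ j, P.real (F j) ≤ u j)
    (hu : Summable u) : P.real E ≤ ∑' j, u j := by
  have hu0 : ∀ j, 0 ≤ u j := fun j => measureReal_nonneg.trans (hF j)
  refine ENNReal.toReal_le_of_le_ofReal (tsum_nonneg hu0) ?_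
  rw [ENNReal.ofReal_tsum_of_nonneg hu0 hu]
  refine (measure_mono hE).trans ((measure_iUnion_le _).trans (ENNReal.tsum_le_tsum fun j => ?_))
  rw [← ofReal_measureReal]
  exact ENNReal.ofReal_le_ofReal (hF j)

/-- The variables `x` drive an on/off process with interarrival law `ν` and parameter `p`. -/
structure IsRenewal {Ω : Type*} [MeasurableSpace Ω] (P : Measure Ω) (p : ℝ) (ν : Measure ℝ)
    (x : RenewalVar → Ω → ℝ) : Prop where
  measurable : ∀ v, Measurable (x v)
  indep : iIndepFun x P
  gap_law : ∀ l, P.map (x (.gap l)) = ν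
  delay_law : ∀ s : ℝ, 0 ≤ s → P.real {ω | x .delay ω ≤ s} = equilibriumCdf ν s
  state_law : ∀ j, P.real {ω | x (.state j) ω = 1} = p ∧ P.real {ω | x (.state j) ω = 0} = 1 - p

theorem IsDrivingFamily.isRenewal {Ω : Type*} [MeasurableSpace Ω] {P : Measure Ω} {n : ℕ}
    {p : ℕ → ℝ} {ν : ℕ → Measure ℝ} {ξ : Simplex n → RenewalVar → Ω → ℝ}
    (h : IsDrivingFamily P n p ν ξ) (A : Simplex n) : IsRenewal P (p A.dim) (ν A.dim) (ξ A) where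
  measurable := h.measurable A
  indep := h.indep.precomp (g := fun v => (A, v)) fun _ _ h => (Prod.ext_iff.1 h).2
  gap_law := h.gap_law A
  delay_law := h.delay_law A
  state_law := h.state_law A

/-! ### Tail bounds for renewal times -/

/-- A law of positive interarrival times. -/
structure IsGapLaw (ν : Measure ℝ) : Prop where
  prob : IsProbabilityMeasure ν
  pos : ∀ᵐ x ∂ν, 0 < x

/-- The Laplace transform at `1`. -/
def laplaceOne (ν : Measure ℝ) : ℝ := ∫ z, Real.exp (-z) ∂ν

/-- A bound for the probability that the `j`-th renewal happens before `T`. -/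
def tailBound (ν : Measure ℝ) (T : ℝ) (j : ℕ) : ℝ := Real.exp T * laplaceOne ν ^ (j - 1)

theorem laplaceOne_nonneg (ν : Measure ℝ) : 0 ≤ laplaceOne ν :=
  integral_nonneg fun _ => (Real.exp_pos _).le

namespace IsGapLaw

variable {ν : Measure ℝ}

theorem integrable_exp (h : IsGapLaw ν) : Integrable (fun z => Real.exp (-z)) ν := by
  have := h.prob
  refine Integrable.of_bound (by fun_prop) 1 ?_
  filter_upwards [h.pos] with z hz
  rw [Real.norm_eq_abs, abs_of_pos (Real.exp_pos _), Real.exp_le_one_iff]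
  linarith

/-- Strictness comes from positivity of the gaps and makes `tailBound` summable as a geometric
sequence. -/
theorem laplaceOne_lt_one (h : IsGapLaw ν) : laplaceOne ν < 1 := by
  have := h.prob
  have h1 : ∫ _, (1 : ℝ) ∂ν = 1 := by simp
  have h2 : 0 < ∫ z, (1 - Real.exp (-z)) ∂ν := by
    rw [integral_pos_iff_support_of_nonneg_ae]
    · have : (Function.support fun z => 1 - Real.exp (-z)) =ᵐ[ν] Set.univ := by
        filter_upwards [h.pos] with z hz
        have : Real.exp (-z) < 1 := by rw [Real.exp_lt_one_iff]; linarith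
        have h3 : z ∈ Function.support fun z => 1 - Real.exp (-z) := by
          rw [Function.mem_support]; linarith
        exact propext ⟨fun _ => trivial, fun _ => h3⟩
      rw [measure_congr this, measure_univ]
      exact one_pos
    · filter_upwards [h.pos] with z hz
      have : Real.exp (-z) ≤ 1 := by rw [Real.exp_le_one_iff]; linarith
      simpa using this
    · exact (integrable_const _).sub h.integrable_exp
  rw [integral_sub (integrable_const _) h.integrable_exp, h1] at h2
  unfold laplaceOne
  linarith

theorem summable_tailBound (h : IsGapLaw ν) (T : ℝ) : Summable (tailBound ν T) := by
  rw [← summable_nat_add_iff 1]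
  exact (summable_geometric_of_lt_one (laplaceOne_nonneg ν) h.laplaceOne_lt_one).mul_left _

theorem tailBound_succ_le (h : IsGapLaw ν) (T : ℝ) (j : ℕ) :
    tailBound ν T (j + 1) ≤ tailBound ν T j :=
  mul_le_mul_of_nonneg_left (pow_le_pow_of_le_one (laplaceOne_nonneg ν) h.laplaceOne_lt_one.le
    (by omega)) (Real.exp_pos _).le

end IsGapLaw

theorem tailBound_nonneg (ν : Measure ℝ) (T : ℝ) (j : ℕ) : 0 ≤ tailBound ν T j :=
  mul_nonneg (Real.exp_pos _).le (pow_nonneg (laplaceOne_nonneg ν) _)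

namespace IsRenewal

variable {Ω : Type*} [MeasurableSpace Ω] {P : Measure Ω} {p : ℝ} {ν : Measure ℝ}
  {x : RenewalVar → Ω → ℝ}

theorem ae_gap_pos (h : IsRenewal P p ν x) (hν : IsGapLaw ν) :
    ∀ᵐ ω ∂P, ∀ l, 0 < x (.gap l) ω := by
  rw [ae_all_iff]
  intro l
  have := hν.pos
  rw [← h.gap_law l] at this
  exact ae_of_ae_map (h.measurable _).aemeasurable this

variable [IsProbabilityMeasure P]

theorem ae_delay_pos (h : IsRenewal P p ν x) : ∀ᵐ ω ∂P, 0 < x .delay ω := by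
  have h1 := h.delay_law 0 le_rfl
  rw [equilibriumCdf, intervalIntegral.integral_same, mul_zero, measureReal_eq_zero_iff] at h1
  have : ∀ᵐ ω ∂P, ¬ x .delay ω ≤ 0 := measure_eq_zero_iff_ae_notMem.1 h1
  filter_upwards [this] with ω hω using not_le.1 hω

theorem ae_state (h : IsRenewal P p ν x) :
    ∀ᵐ ω ∂P, ∀ j, x (.state j) ω = 0 ∨ x (.state j) ω = 1 := by
  rw [ae_all_iff]
  intro j
  obtain ⟨h1, h0⟩ := h.state_law j
  have hd : Disjoint {ω | x (.state j) ω = 0} {ω | x (.state j) ω = 1} := by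
    rw [Set.disjoint_left]
    intro ω h0 h1
    rw [Set.mem_ofPred_eq] at h0 h1
    rw [h0] at h1
    exact zero_ne_one h1
  have hm : ∀ c, MeasurableSet {ω | x (.state j) ω = c} := fun c =>
    measurableSet_eq_fun (h.measurable _) measurable_const
  have hu : P.real ({ω | x (.state j) ω = 0} ∪ {ω | x (.state j) ω = 1}) = 1 := by
    rw [measureReal_union hd (hm 1), h0, h1]; ring
  have hu' : P ({ω | x (.state j) ω = 0} ∪ {ω | x (.state j) ω = 1}) = 1 := by
    rw [← ofReal_measureReal, hu, ENNReal.ofReal_one]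
  exact (prob_compl_eq_zero_iff ((hm 0).union (hm 1))).2 hu'

/-- Chernoff bound at parameter `-1`: for independent gaps the moment generating function of the sum
is a power of `laplaceOne ν`. -/
theorem measureReal_gapSum_le (h : IsRenewal P p ν x) (hν : IsGapLaw ν) (T : ℝ) (j : ℕ) :
    P.real {ω | ∑ l ∈ Finset.range j, x (.gap l) ω ≤ T} ≤ Real.exp T * laplaceOne ν ^ j := by
  have hmgf : ∀ l, mgf (x (.gap l)) P (-1) = laplaceOne ν := fun l => by
    unfold mgf laplaceOne
    rw [← h.gap_law l, integral_map (h.measurable _).aemeasurable (by fun_prop)]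
    simp
  have hind : iIndepFun (fun l => x (.gap l)) P :=
    h.indep.precomp (g := RenewalVar.gap) fun _ _ h => by simpa using h
  have hsum := hind.mgf_sum (t := -1) (fun l => h.measurable _) (Finset.range j)
  rw [Finset.prod_congr rfl fun l _ => hmgf l, Finset.prod_const, Finset.card_range] at hsum
  have hint : Integrable
      (fun ω => Real.exp (-1 * (∑ l ∈ Finset.range j, x (.gap l)) ω)) P := by
    refine Integrable.of_bound ?_ 1 ?_
    · have : ∀ l, Measurable (x (.gap l)) := fun l => h.measurable _
      simp only [Finset.sum_apply]
      fun_prop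
    · filter_upwards [h.ae_gap_pos hν] with ω hω
      rw [Real.norm_eq_abs, abs_of_pos (Real.exp_pos _), Real.exp_le_one_iff, Finset.sum_apply]
      have : 0 ≤ ∑ l ∈ Finset.range j, x (.gap l) ω := Finset.sum_nonneg fun l _ => (hω l).le
      linarith
  have := measure_le_le_exp_mul_mgf T (by norm_num : (-1 : ℝ) ≤ 0) hint
  rw [hsum] at this
  simpa using this

theorem measureReal_renewalTime_le (h : IsRenewal P p ν x) (hν : IsGapLaw ν) {T : ℝ} (hT : 0 ≤ T)
    (j : ℕ) : P.real {ω | renewalTime (fun v => x v ω) j ≤ T} ≤ tailBound ν T j := by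
  cases j with
  | zero =>
    -- The exponent `j - 1` truncates to `0`, so the bound at `j = 0` is `exp T ≥ 1`.
    refine measureReal_le_one.trans ?_
    simpa [tailBound] using hT
  | succ j =>
    refine le_trans ?_ (h.measureReal_gapSum_le hν T j)
    refine ENNReal.toReal_mono (measure_ne_top _ _) (measure_mono_ae ?_)
    filter_upwards [h.ae_delay_pos] with ω hω h1
    change x .delay ω + ∑ l ∈ Finset.range j, x (.gap l) ω ≤ T at h1
    change ∑ l ∈ Finset.range j, x (.gap l) ω ≤ T
    linarith

theorem ae_goodPath (h : IsRenewal P p ν x) (hν : IsGapLaw ν) :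
    ∀ᵐ ω ∂P, GoodPath fun v => x v ω := by
  -- Borel–Cantelli: almost surely only finitely many renewals happen before each integer time.
  have hT : ∀ᵐ ω ∂P, ∀ N : ℕ, ∀ᶠ j in atTop, ¬ renewalTime (fun v => x v ω) j ≤ N := by
    rw [ae_all_iff]
    intro N
    refine ae_eventually_notMem (s := fun j => {ω | renewalTime (fun v => x v ω) j ≤ N}) ?_
    refine ne_top_of_le_ne_top (hν.summable_tailBound N).tsum_ofReal_ne_top
      (ENNReal.tsum_le_tsum fun j => ?_)
    rw [← ofReal_measureReal]
    exact ENNReal.ofReal_le_ofReal (h.measureReal_renewalTime_le hν (Nat.cast_nonneg N) j)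
  filter_upwards [h.ae_delay_pos, h.ae_gap_pos hν, h.ae_state, hT] with ω h1 h2 h3 h4
  refine ⟨h3, strictMono_nat_of_lt_succ fun j => ?_, tendsto_atTop.2 fun c => ?_⟩
  · cases j with
    | zero => simpa [renewalTime] using h1
    | succ j =>
      simp only [renewalTime, Finset.sum_range_succ]
      linarith [h2 j]
  · obtain ⟨N, hN⟩ := exists_nat_ge c
    filter_upwards [h4 N] with j hj
    linarith

/-- The equilibrium law has density `(1 - G)/μ` on the positive half-line, at most `1/μ`; the
absolute value avoids the sign of `μ`. Negative endpoints are allowed because the interval will be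
shifted by a sum of gaps. -/
theorem measureReal_delay_Ioc_le (h : IsRenewal P p ν x) {s t : ℝ} (hst : s ≤ t) :
    P.real {ω | x .delay ω ∈ Set.Ioc s t} ≤ |1 / ∫ z, z ∂ν| * (t - s) := by
  have key : ∀ s t : ℝ, 0 ≤ s → s ≤ t →
      P.real {ω | x .delay ω ∈ Set.Ioc s t} ≤ |1 / ∫ z, z ∂ν| * (t - s) := by
    intro s t hs hst
    have hset : {ω | x .delay ω ∈ Set.Ioc s t} =
        {ω | x .delay ω ≤ t} \ {ω | x .delay ω ≤ s} := by
      ext ω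
      simp only [Set.mem_ofPred_eq, Set.mem_Ioc, Set.mem_sdiff, not_le]
      tauto
    have hint : ∀ a b : ℝ, IntervalIntegrable (fun y => 1 - cdf ν y) volume a b := fun a b =>
      intervalIntegrable_const.sub (monotone_cdf ν).intervalIntegrable
    have hsub : {ω | x .delay ω ≤ s} ⊆ {ω | x .delay ω ≤ t} := fun ω hω => le_trans hω hst
    rw [hset, measureReal_sdiff hsub
      (measurableSet_le (h.measurable _) measurable_const), h.delay_law t (hs.trans hst),
      h.delay_law s hs, equilibriumCdf, equilibriumCdf, ← mul_sub,
      intervalIntegral.integral_interval_sub_left (hint _ _) (hint _ _)]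
    refine (le_abs_self _).trans ?_
    rw [abs_mul]
    refine mul_le_mul_of_nonneg_left ?_ (abs_nonneg _)
    have := intervalIntegral.norm_integral_le_of_norm_le_const (a := s) (b := t) (C := 1)
      (f := fun y => 1 - cdf ν y) fun y _ => by
        rw [Real.norm_eq_abs, abs_le]
        constructor <;> linarith [cdf_nonneg ν y, cdf_le_one ν y]
    rwa [one_mul, abs_of_nonneg (sub_nonneg.2 hst)] at this
  have hle : P.real {ω | x .delay ω ∈ Set.Ioc s t} ≤
      P.real {ω | x .delay ω ∈ Set.Ioc (max s 0) (max t 0)} := by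
    refine ENNReal.toReal_mono (measure_ne_top _ _) (measure_mono_ae ?_)
    filter_upwards [h.ae_delay_pos] with ω hω h1
    exact ⟨max_lt h1.1 hω, h1.2.trans (le_max_left _ _)⟩
  refine hle.trans ((key _ _ (le_max_right _ _) (max_le_max_right 0 hst)).trans ?_)
  refine mul_le_mul_of_nonneg_left ?_ (abs_nonneg _)
  rcases le_total s 0 with hs | hs <;> rcases le_total t 0 with ht | ht <;>
    simp only [max_eq_left, max_eq_right, hs, ht] <;> linarith

end IsRenewal

/-! ### Independence of states and renewal times; probabilities of being on and of switching -/

namespace IsRenewal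

variable {Ω : Type*} [MeasurableSpace Ω] {P : Measure Ω} {p : ℝ} {ν : Measure ℝ}
  {x : RenewalVar → Ω → ℝ}

theorem nonneg (h : IsRenewal P p ν x) : 0 ≤ p := by
  rw [← (h.state_law 0).1]
  exact measureReal_nonneg

/-- Both renewal times are functions of the delay and the first `j` gaps, a finite set of variables
that does not contain the state. -/
theorem indepFun_state (h : IsRenewal P p ν x) (j : ℕ) :
    IndepFun (x (.state j)) (fun ω => (renewalTime (fun v => x v ω) j,
      renewalTime (fun v => x v ω) (j + 1))) P := by
  classical
  set S : Finset RenewalVar := insert .delay ((Finset.range j).image .gap) with hS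
  have hd : Disjoint {RenewalVar.state j} S := by simp [hS]
  -- Extension by zero lets `renewalTime` be evaluated on the variables in `S` alone.
  let ext : (S → ℝ) → RenewalVar → ℝ := fun f v => if hv : v ∈ S then f ⟨v, hv⟩ else 0
  have hext : Measurable ext := by
    refine measurable_pi_iff.2 fun v => ?_
    by_cases hv : v ∈ S
    · simp only [ext, hv, dite_true]; exact measurable_pi_apply _
    · simp only [ext, hv, dite_false]; exact measurable_const
  have h1 := (h.indep.indepFun_finset _ _ hd h.measurable).comp
    (measurable_pi_apply (⟨.state j, Finset.mem_singleton_self _⟩ :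
      ({RenewalVar.state j} : Finset RenewalVar)))
    (((measurable_renewalTime j).comp hext).prodMk ((measurable_renewalTime (j + 1)).comp hext))
  refine h1.congr (Eventually.of_forall fun _ => rfl) (Eventually.of_forall fun ω => ?_)
  have hdel : ext (fun i : S => x i ω) .delay = x .delay ω := by simp [ext, hS]
  have hgap : ∀ l < j, ext (fun i : S => x i ω) (.gap l) = x (.gap l) ω := fun l hl => by
    simp [ext, hS, hl]
  refine Prod.ext ?_ ?_
  · cases j with
    | zero => rfl
    | succ j =>
      simp only [renewalTime, Function.comp, hdel]
      congr 1
      exact Finset.sum_congr rfl fun l hl => hgap l (by have := Finset.mem_range.1 hl; omega)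
  · simp only [renewalTime, Function.comp, hdel]
    congr 1
    exact Finset.sum_congr rfl fun l hl => hgap l (Finset.mem_range.1 hl)

variable [IsProbabilityMeasure P]

/-- Conditionally on the sum of gaps, which is independent of the delay, the delay must fall in a
translate of the interval, and the bound for the delay is translation invariant. -/
theorem measureReal_renewalTime_Ioc_le (h : IsRenewal P p ν x) {s t : ℝ} (hs : 0 ≤ s)
    (hst : s ≤ t) (j : ℕ) :
    P.real {ω | renewalTime (fun v => x v ω) j ∈ Set.Ioc s t} ≤ |1 / ∫ z, z ∂ν| * (t - s) := by
  classical
  cases j with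
  | zero =>
    have : {ω | renewalTime (fun v => x v ω) 0 ∈ Set.Ioc s t} = ∅ := by
      rw [Set.eq_empty_iff_forall_notMem]
      rintro ω ⟨h1, -⟩
      simp only [renewalTime] at h1
      linarith
    rw [this, measureReal_empty]
    exact mul_nonneg (abs_nonneg _) (sub_nonneg.2 hst)
  | succ j =>
    set R : Ω → ℝ := fun ω => ∑ l ∈ Finset.range j, x (.gap l) ω with hR
    have hRm : Measurable R := Finset.measurable_sum _ fun l _ => h.measurable _
    have hD := h.measurable .delay
    have hind : IndepFun R (x .delay) P := by
      have h1 : RenewalVar.delay ∉ (Finset.range j).image RenewalVar.gap := by simp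
      have h2 := h.indep.indepFun_finsetSum_of_notMem h.measurable h1
      rwa [Finset.sum_image fun a _ b _ hab => by simpa using hab, show
        ∑ l ∈ Finset.range j, x (.gap l) = R by ext ω; simp [hR]] at h2
    have hprod := (indepFun_iff_map_prod_eq_prod_map_map hRm.aemeasurable hD.aemeasurable).1 hind
    have hms : MeasurableSet {q : ℝ × ℝ | q.2 + q.1 ∈ Set.Ioc s t} :=
      (measurable_snd.add measurable_fst) measurableSet_Ioc
    have hset : {ω | renewalTime (fun v => x v ω) (j + 1) ∈ Set.Ioc s t} =
        (fun ω => (R ω, x .delay ω)) ⁻¹' {q : ℝ × ℝ | q.2 + q.1 ∈ Set.Ioc s t} := rfl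
    have hRP : IsProbabilityMeasure (P.map R) := Measure.isProbabilityMeasure_map hRm.aemeasurable
    refine ENNReal.toReal_le_of_le_ofReal (mul_nonneg (abs_nonneg _) (sub_nonneg.2 hst)) ?_
    rw [hset, ← Measure.map_apply (hRm.prodMk hD) hms, hprod, Measure.prod_apply hms]
    calc ∫⁻ r, P.map (x .delay) (Prod.mk r ⁻¹' {q : ℝ × ℝ | q.2 + q.1 ∈ Set.Ioc s t}) ∂P.map R
        ≤ ∫⁻ _, ENNReal.ofReal (|1 / ∫ z, z ∂ν| * (t - s)) ∂P.map R := by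
          refine lintegral_mono fun r => ?_
          rw [Measure.map_apply hD (measurable_prodMk_left hms)]
          have := h.measureReal_delay_Ioc_le (sub_le_sub_right hst r)
          rw [show t - r - (s - r) = t - s by ring] at this
          refine le_trans (le_of_eq ?_) (ENNReal.ofReal_le_ofReal this)
          rw [ofReal_measureReal]
          congr 1
          ext ω
          simp only [Set.mem_preimage, Set.mem_ofPred_eq, Set.mem_Ioc, sub_lt_iff_lt_add,
            le_sub_iff_add_le]
      _ = _ := by simp

theorem measure_state_inter (h : IsRenewal P p ν x) (j : ℕ) {Q : Set (ℝ × ℝ)}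
    (hQ : MeasurableSet Q) :
    P ({ω | x (.state j) ω = 1} ∩ {ω | (renewalTime (fun v => x v ω) j,
      renewalTime (fun v => x v ω) (j + 1)) ∈ Q}) = ENNReal.ofReal p *
    P {ω | (renewalTime (fun v => x v ω) j, renewalTime (fun v => x v ω) (j + 1)) ∈ Q} := by
  have h1 := (h.indepFun_state j).measure_inter_preimage_eq_mul {1} Q (measurableSet_singleton 1) hQ
  rw [← (h.state_law j).1, ofReal_measureReal]
  exact h1

theorem measureReal_state_inter (h : IsRenewal P p ν x) (j : ℕ) {Q : Set (ℝ × ℝ)}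
    (hQ : MeasurableSet Q) :
    P.real ({ω | x (.state j) ω = 1} ∩ {ω | (renewalTime (fun v => x v ω) j,
      renewalTime (fun v => x v ω) (j + 1)) ∈ Q}) = p *
    P.real {ω | (renewalTime (fun v => x v ω) j, renewalTime (fun v => x v ω) (j + 1)) ∈ Q} := by
  rw [Measure.real, h.measure_state_inter j hQ, ENNReal.toReal_mul, ENNReal.toReal_ofReal h.nonneg,
    Measure.real]

/-- Independence extracts the factor `p` from each term of the union over `j`. Allowing a whole time
interval thus costs only a constant compared with a fixed time. -/
theorem measureReal_onBy_le (h : IsRenewal P p ν x) (hν : IsGapLaw ν) {T : ℝ} (hT : 0 ≤ T) :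
    P.real {ω | OnBy (fun v => x v ω) T} ≤ (∑' j, tailBound ν T j) * p := by
  rw [mul_comm, ← tsum_mul_left]
  refine measureReal_le_tsum (F := fun j => {ω | x (.state j) ω = 1} ∩
    {ω | (renewalTime (fun v => x v ω) j, renewalTime (fun v => x v ω) (j + 1)) ∈
      {q : ℝ × ℝ | q.1 ≤ T}}) ?_ (fun j => ?_) ((hν.summable_tailBound T).mul_left p)
  · rintro ω ⟨j, h1, h2⟩
    exact Set.mem_iUnion.2 ⟨j, h1, h2⟩
  · rw [h.measureReal_state_inter j (measurableSet_le measurable_fst measurable_const)]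
    exact mul_le_mul_of_nonneg_left (h.measureReal_renewalTime_le hν hT j) h.nonneg

/-- A bound for the expected number of switches in an interval of length `d` before `T`. -/
def switchBound (ν : Measure ℝ) (T d : ℝ) : ℝ :=
  ∑' j, 2 * min (|1 / ∫ z, z ∂ν| * d) (tailBound ν T j)

theorem summable_switchBound (hν : IsGapLaw ν) (T : ℝ) {d : ℝ} (hd : 0 ≤ d) :
    Summable fun j => 2 * min (|1 / ∫ z, z ∂ν| * d) (tailBound ν T j) := by
  refine Summable.mul_left 2 (Summable.of_nonneg_of_le (fun j => ?_) (fun j => min_le_right _ _)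
    (hν.summable_tailBound T))
  exact le_min (mul_nonneg (abs_nonneg _) hd) (tailBound_nonneg ν T j)

theorem switchBound_nonneg (ν : Measure ℝ) (T : ℝ) {d : ℝ} (hd : 0 ≤ d) :
    0 ≤ switchBound ν T d :=
  tsum_nonneg fun j => mul_nonneg zero_le_two
    (le_min (mul_nonneg (abs_nonneg _) hd) (tailBound_nonneg ν T j))

/-- Dominated convergence: the first entry of each minimum vanishes with the interval length, the
second is summable in `j`. -/
theorem tendsto_switchBound (hν : IsGapLaw ν) (T : ℝ) :
    Tendsto (fun m : ℕ => switchBound ν T (1 / ((m : ℝ) + 1))) atTop (𝓝 0) := by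
  have h1 : Tendsto (fun m : ℕ => 1 / ((m : ℝ) + 1)) atTop (𝓝 0) :=
    tendsto_one_div_add_atTop_nhds_zero_nat
  have := tendsto_tsum_of_dominated_convergence (𝓕 := atTop)
    (f := fun (m : ℕ) j => 2 * min (|1 / ∫ z, z ∂ν| * (1 / ((m : ℝ) + 1))) (tailBound ν T j))
    (g := fun _ => 0) ((hν.summable_tailBound T).mul_left 2) (fun j => ?_)
    (Eventually.of_forall fun m j => ?_)
  · simpa [switchBound] using this
  · have h2 := ((h1.const_mul (|1 / ∫ z, z ∂ν|)).min
      (tendsto_const_nhds (x := tailBound ν T j))).const_mul 2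
    simpa [min_eq_left (tailBound_nonneg ν T j)] using h2
  · have h0 : 0 ≤ |1 / ∫ z, z ∂ν| * (1 / ((m : ℝ) + 1)) := by positivity
    rw [Real.norm_eq_abs, abs_of_nonneg
      (mul_nonneg zero_le_two (le_min h0 (tailBound_nonneg ν T j)))]
    exact mul_le_mul_of_nonneg_left (min_le_right _ _) zero_le_two

theorem measureReal_switchIn_le (h : IsRenewal P p ν x) (hν : IsGapLaw ν) {s t T : ℝ}
    (hs : 0 ≤ s) (hst : s ≤ t) (htT : t ≤ T) :
    P.real {ω | SwitchIn (fun v => x v ω) s t} ≤ switchBound ν T (t - s) * p := by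
  unfold switchBound
  rw [mul_comm, ← tsum_mul_left]
  refine measureReal_le_tsum (F := fun j => {ω | x (.state j) ω = 1} ∩
    {ω | (renewalTime (fun v => x v ω) j, renewalTime (fun v => x v ω) (j + 1)) ∈
      {q : ℝ × ℝ | q.1 ∈ Set.Ioc s t ∨ q.2 ∈ Set.Ioc s t}}) ?_ (fun j => ?_)
      ((summable_switchBound hν T (sub_nonneg.2 hst)).mul_left p)
  · rintro ω ⟨j, h1, h2⟩
    exact Set.mem_iUnion.2 ⟨j, h1, h2⟩
  · have hQ : MeasurableSet {q : ℝ × ℝ | q.1 ∈ Set.Ioc s t ∨ q.2 ∈ Set.Ioc s t} :=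
      (measurable_fst measurableSet_Ioc).union (measurable_snd measurableSet_Ioc)
    rw [h.measureReal_state_inter j hQ]
    refine mul_le_mul_of_nonneg_left ?_ h.nonneg
    have hb : ∀ i, P.real {ω | renewalTime (fun v => x v ω) i ∈ Set.Ioc s t} ≤
        min (|1 / ∫ z, z ∂ν| * (t - s)) (tailBound ν T i) := fun i =>
      le_min (h.measureReal_renewalTime_Ioc_le hs hst i)
        ((measureReal_mono fun ω hω => le_trans hω.2 htT).trans
          (h.measureReal_renewalTime_le hν (hs.trans (hst.trans htT)) i))
    refine (measureReal_union_le {ω | renewalTime (fun v => x v ω) j ∈ Set.Ioc s t}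
      {ω | renewalTime (fun v => x v ω) (j + 1) ∈ Set.Ioc s t}).trans ?_
    have h1 := hb j
    -- Tail bounds decrease in `j`, so the right endpoint obeys the bound of the left one; hence the
    -- factor `2` in `switchBound`.
    have h2 := (hb (j + 1)).trans (min_le_min_left _ (hν.tailBound_succ_le T j))
    linarith

/-- Almost surely exactly one renewal interval covers `t`, and its state is independent of its
endpoints. Summing over the index of that interval gives `p`; stationarity of the renewal process
plays no role. -/
theorem measureReal_onAt (h : IsRenewal P p ν x) (hν : IsGapLaw ν) {t : ℝ} (ht : 0 ≤ t) :
    P.real {ω | OnAt (fun v => x v ω) t} = p := by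
  set Q : Set (ℝ × ℝ) := {q | q.1 ≤ t ∧ t < q.2} with hQ
  have hQm : MeasurableSet Q := (measurableSet_le measurable_fst measurable_const).inter
    (measurableSet_lt measurable_const measurable_snd)
  set F : ℕ → Set Ω := fun j =>
    {ω | (renewalTime (fun v => x v ω) j, renewalTime (fun v => x v ω) (j + 1)) ∈ Q} with hF
  have hxm : Measurable fun ω v => x v ω := measurable_pi_iff.2 h.measurable
  have hFm : ∀ j, MeasurableSet (F j) := fun j =>
    (((measurable_renewalTime j).comp hxm).prodMk ((measurable_renewalTime (j + 1)).comp hxm)) hQm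
  have hSm : ∀ j, MeasurableSet {ω | x (.state j) ω = 1} := fun j =>
    measurableSet_eq_fun (h.measurable _) measurable_const
  have hdisj : Pairwise (Function.onFun (AEDisjoint P) F) := by
    intro i j hij
    have : ∀ᵐ ω ∂P, ω ∉ F i ∩ F j := by
      filter_upwards [h.ae_goodPath hν] with ω hω
      rintro ⟨⟨h1, h2⟩, ⟨h3, h4⟩⟩
      simp only at h1 h2 h3 h4
      rcases lt_or_gt_of_ne hij with hlt | hlt
      · have := hω.mono.monotone (Nat.succ_le_of_lt hlt)
        simp only [Nat.succ_eq_add_one] at this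
        linarith
      · have := hω.mono.monotone (Nat.succ_le_of_lt hlt)
        simp only [Nat.succ_eq_add_one] at this
        linarith
    exact measure_eq_zero_iff_ae_notMem.2 this
  have hone : ∑' j, P (F j) = 1 := by
    rw [← measure_iUnion₀ hdisj fun j => (hFm j).nullMeasurableSet]
    refine (prob_compl_eq_zero_iff (MeasurableSet.iUnion hFm)).1
      (measure_eq_zero_iff_ae_notMem.2 ?_)
    filter_upwards [h.ae_goodPath hν] with ω hω
    obtain ⟨j, h1, h2⟩ := hω.exists_index ht
    exact fun hc => hc (Set.mem_iUnion.2 ⟨j, h1, h2⟩)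
  have hset : {ω | OnAt (fun v => x v ω) t} = ⋃ j, ({ω | x (.state j) ω = 1} ∩ F j) := by
    ext ω
    simp only [OnAt, Set.mem_ofPred_eq, Set.mem_iUnion, Set.mem_inter_iff, hF, hQ]
  have hP : P {ω | OnAt (fun v => x v ω) t} = ENNReal.ofReal p := by
    rw [hset, measure_iUnion₀
      (fun i j hij => (hdisj hij).mono Set.inter_subset_right Set.inter_subset_right)
      fun j => ((hSm j).inter (hFm j)).nullMeasurableSet]
    simp only [hF, h.measure_state_inter _ hQm]
    rw [ENNReal.tsum_mul_left]
    have := hone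
    simp only [hF] at this
    rw [this, mul_one]
  rw [Measure.real, hP, ENNReal.toReal_ofReal h.nonneg]

end IsRenewal

/-! ### Families of simplices -/

/-- The simplices of positive dimension contained in `A`. -/
def subs {n : ℕ} (A : Finset (Fin n)) : Finset (Simplex n) := Finset.univ.filter fun B => B.1 ⊆ A

theorem mem_subs {n : ℕ} {A : Finset (Fin n)} {B : Simplex n} : B ∈ subs A ↔ B.1 ⊆ A := by
  simp [subs]

theorem Simplex.one_le_dim {n : ℕ} (B : Simplex n) : 1 ≤ B.dim := by
  have := B.2
  unfold Simplex.dim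
  omega

theorem dim_lt_of_mem_subs {n : ℕ} {A : Finset (Fin n)} {B : Simplex n} (h : B ∈ subs A) :
    B.dim < A.card := by
  have h1 := Finset.card_le_card (mem_subs.1 h)
  have h2 := B.2
  unfold Simplex.dim
  omega

theorem subs_inter {n : ℕ} (A A' : Finset (Fin n)) : subs A ∩ subs A' = subs (A ∩ A') := by
  ext B
  simp only [Finset.mem_inter, mem_subs, Finset.subset_inter_iff]

theorem subs_eq_empty {n : ℕ} {A : Finset (Fin n)} (h : A.card ≤ 1) : subs A = ∅ := by
  rw [Finset.eq_empty_iff_forall_notMem]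
  intro B hB
  have h1 := Finset.card_le_card (mem_subs.1 hB)
  have h2 := B.2
  omega

theorem card_subs_le {n : ℕ} (A : Finset (Fin n)) : (subs A).card ≤ 2 ^ A.card := by
  rw [← Finset.card_powerset]
  exact Finset.card_le_card_of_injOn (fun B => B.1)
    (fun B hB => Finset.mem_coe.2 (Finset.mem_powerset.2 (mem_subs.1 hB)))
    fun B _ B' _ h => Subtype.ext h

theorem sum_subs {n : ℕ} {b : ℕ → ℝ} (hb : b 0 = 0) (A : Finset (Fin n)) :
    ∑ B ∈ subs A, b B.dim = faceExp b A.card := by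
  rw [← sum_powerset_eq_faceExp hb A]
  refine Finset.sum_bij_ne_zero (fun B _ _ => B.1)
    (fun B hB _ => Finset.mem_powerset.2 (mem_subs.1 hB)) (fun B _ _ B' _ _ h => Subtype.ext h)
    (fun C hC hC0 => ?_) fun B _ _ => rfl
  have h2 : 2 ≤ C.card := by
    by_contra hlt
    refine hC0 ?_
    rw [show C.card - 1 = 0 by omega, hb]
  exact ⟨⟨C, h2⟩, mem_subs.2 (Finset.mem_powerset.1 hC), hC0, rfl⟩

theorem sum_subs_union {n : ℕ} {b : ℕ → ℝ} (hb : b 0 = 0) (A A' : Finset (Fin n)) :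
    ∑ B ∈ subs A ∪ subs A', b B.dim =
      faceExp b A.card + faceExp b A'.card - faceExp b (A ∩ A').card := by
  have h := Finset.sum_union_inter (s₁ := subs A) (s₂ := subs A') (f := fun B => b B.dim)
  rw [subs_inter, sum_subs hb, sum_subs hb, sum_subs hb] at h
  linarith

/-- The set `A'` is determined by `A ∩ A'`, a subset of `A`, and by `A' \ A`, which has `m - w`
elements. -/
theorem card_inter_eq_le {n m w : ℕ} (A : Finset (Fin n)) :
    (((Finset.univ : Finset (Fin n)).powersetCard m).filter fun A' => (A ∩ A').card = w).card ≤
      2 ^ A.card * n ^ (m - w) := by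
  calc _ ≤ (A.powerset ×ˢ (Finset.univ : Finset (Fin n)).powersetCard (m - w)).card := by
        refine Finset.card_le_card_of_injOn (fun A' => (A ∩ A', A' \ A)) (fun A' hA' => ?_) ?_
        · obtain ⟨h1, h2⟩ := Finset.mem_filter.1 (Finset.mem_coe.1 hA')
          have h3 := (Finset.mem_powersetCard.1 h1).2
          refine Finset.mem_coe.2 (Finset.mem_product.2
            ⟨Finset.mem_powerset.2 Finset.inter_subset_left, Finset.mem_powersetCard.2
              ⟨Finset.subset_univ _, ?_⟩⟩)
          rw [Finset.card_sdiff, h3, h2]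
        · intro A' _ A'' _ h
          obtain ⟨h1, h2⟩ := Prod.ext_iff.1 h
          simp only at h1 h2
          ext v
          have h3 := Finset.ext_iff.1 h1 v
          have h4 := Finset.ext_iff.1 h2 v
          simp only [Finset.mem_inter, Finset.mem_sdiff] at h3 h4
          tauto
    _ ≤ _ := by
        rw [Finset.card_product, Finset.card_powerset, Finset.card_powersetCard, Finset.card_univ,
          Fintype.card_fin]
        exact Nat.mul_le_mul_left _ (Nat.choose_le_pow n _)

/-- An event that depends only on the processes of the simplices inside `A`. -/
def IsLocal {Ω : Type*} {n : ℕ} (ξ : Simplex n → RenewalVar → Ω → ℝ) (A : Finset (Fin n))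
    (E : Set Ω) : Prop :=
  ∃ M : Set (subs A → RenewalVar → ℝ), MeasurableSet M ∧ E = (fun ω B v => ξ B.1 v ω) ⁻¹' M

namespace IsDrivingFamily

variable {Ω : Type*} [MeasurableSpace Ω] {P : Measure Ω} {n : ℕ} {p : ℕ → ℝ} {ν : ℕ → Measure ℝ}
  {ξ : Simplex n → RenewalVar → Ω → ℝ}

theorem measurable_path (h : IsDrivingFamily P n p ν ξ) (B : Simplex n) :
    Measurable fun ω v => ξ B v ω := measurable_pi_iff.2 (h.measurable B)

theorem measurableSet_of_isLocal (h : IsDrivingFamily P n p ν ξ) {A : Finset (Fin n)} {E : Set Ω}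
    (hE : IsLocal ξ A E) : MeasurableSet E := by
  obtain ⟨M, hM, rfl⟩ := hE
  exact (measurable_pi_iff.2 fun B : subs A => h.measurable_path B.1) hM

variable [IsProbabilityMeasure P]

/-- The joint law of all variables is a product over simplices and labels; currying makes it a
product over simplices of the laws of the paths. -/
theorem indep_path (h : IsDrivingFamily P n p ν ξ) : iIndepFun (fun B ω v => ξ B v ω) P := by
  have hB : ∀ B v, IsProbabilityMeasure (P.map (ξ B v)) := fun B v =>
    Measure.isProbabilityMeasure_map (h.measurable B v).aemeasurable
  have hm : Measurable fun ω (a : Simplex n × RenewalVar) => ξ a.1 a.2 ω :=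
    measurable_pi_iff.2 fun a => h.measurable a.1 a.2
  rw [iIndepFun_iff_map_fun_eq_infinitePi_map h.measurable_path]
  have h1 := (iIndepFun_iff_map_fun_eq_infinitePi_map
    (X := fun a : Simplex n × RenewalVar => ξ a.1 a.2) fun a => h.measurable a.1 a.2).1 h.indep
  have h2 := congrArg (Measure.map (MeasurableEquiv.curry (Simplex n) RenewalVar ℝ)) h1
  rw [Measure.infinitePi_map_curry (fun B v => P.map (ξ B v)),
    Measure.map_map (MeasurableEquiv.measurable _) hm] at h2
  refine Eq.trans h2 ?_
  congr 1
  ext1 B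
  exact ((iIndepFun_iff_map_fun_eq_infinitePi_map (h.measurable B)).1
    (h.isRenewal B).indep).symm

theorem measureReal_forall_mem (h : IsDrivingFamily P n p ν ξ) (S : Finset (Simplex n))
    {M : Simplex n → Set (RenewalVar → ℝ)} (hM : ∀ B, MeasurableSet (M B)) :
    P.real {ω | ∀ B ∈ S, (fun v => ξ B v ω) ∈ M B} =
      ∏ B ∈ S, P.real {ω | (fun v => ξ B v ω) ∈ M B} := by
  have h1 := h.indep_path.measure_inter_preimage_eq_mul S (sets := M) fun B _ => hM B
  have h2 : {ω | ∀ B ∈ S, (fun v => ξ B v ω) ∈ M B} =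
      ⋂ B ∈ S, (fun ω v => ξ B v ω) ⁻¹' M B := by
    ext ω
    simp
  rw [Measure.real, h2, h1, ENNReal.toReal_prod]
  rfl

/-- Vertex sets sharing at most one vertex have no simplex of positive dimension in common. -/
theorem indepFun_of_isLocal (h : IsDrivingFamily P n p ν ξ) {A A' : Finset (Fin n)} {E E' : Set Ω}
    (hE : IsLocal ξ A E) (hE' : IsLocal ξ A' E') (hA : (A ∩ A').card ≤ 1) :
    IndepFun (E.indicator fun _ => (1 : ℝ)) (E'.indicator fun _ => (1 : ℝ)) P := by
  obtain ⟨M, hM, rfl⟩ := hE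
  obtain ⟨M', hM', rfl⟩ := hE'
  have hd : Disjoint (subs A) (subs A') := by
    rw [Finset.disjoint_iff_inter_eq_empty, subs_inter, subs_eq_empty hA]
  exact (h.indep_path.indepFun_finset _ _ hd h.measurable_path).comp
    (measurable_const.indicator hM) (measurable_const.indicator hM')

end IsDrivingFamily

/-! ### Moments of simplex counts -/

open Classical in
/-- The number of `j`-dimensional simplices on `[n]` with a given property. -/
def count {n : ℕ} (j : ℕ) (q : Finset (Fin n) → Prop) : ℕ :=
  (((Finset.univ : Finset (Fin n)).powersetCard (j + 1)).filter q).card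

theorem count_eq_sum {Ω : Type*} {n j : ℕ} (E : Finset (Fin n) → Set Ω) (ω : Ω) :
    (count j (fun A => ω ∈ E A) : ℝ) =
      ∑ A ∈ (Finset.univ : Finset (Fin n)).powersetCard (j + 1),
        (E A).indicator (fun _ => (1 : ℝ)) ω := by
  classical
  unfold count
  rw [Finset.card_filter]
  push_cast
  refine Finset.sum_congr rfl fun A _ => ?_
  rw [Set.indicator_apply]

theorem card_powersetCard_univ_le (n j : ℕ) :
    (((Finset.univ : Finset (Fin n)).powersetCard (j + 1)).card : ℝ) ≤ (n : ℝ) ^ (j + 1) := by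
  rw [Finset.card_powersetCard, Finset.card_univ, Fintype.card_fin]
  exact_mod_cast Nat.choose_le_pow n (j + 1)

/-- The constant in the variance bound. -/
def varConst (j : ℕ) (c : ℝ) : ℝ := j * (2 ^ (j + 1) * c ^ (2 * 2 ^ (j + 1)))

theorem prod_mul_rpow {n : ℕ} (hn : 1 ≤ n) (S : Finset (Simplex n)) (b : ℕ → ℝ)
    (c : Simplex n → ℝ) : ∏ B ∈ S, c B * (n : ℝ) ^ (-b B.dim) =
      (∏ B ∈ S, c B) * (n : ℝ) ^ (-∑ B ∈ S, b B.dim) := by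
  rw [Finset.prod_mul_distrib, ← Finset.sum_neg_distrib, Real.rpow_sum_of_pos (by positivity)]

namespace IsDrivingFamily

variable {Ω : Type*} [MeasurableSpace Ω] {P : Measure Ω} {n : ℕ} {p : ℕ → ℝ} {ν : ℕ → Measure ℝ}
  {ξ : Simplex n → RenewalVar → Ω → ℝ}

theorem memLp_indicator [IsFiniteMeasure P] (h : IsDrivingFamily P n p ν ξ) {A : Finset (Fin n)}
    {E : Set Ω} (hE : IsLocal ξ A E) : MemLp (E.indicator fun _ => (1 : ℝ)) 2 P :=
  memLp_indicator_const 2 (h.measurableSet_of_isLocal hE) 1 (Or.inr (measure_ne_top _ _))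

theorem memLp_count [IsFiniteMeasure P] (h : IsDrivingFamily P n p ν ξ) (j : ℕ)
    {E : Finset (Fin n) → Set Ω} (hE : ∀ A, IsLocal ξ A (E A)) :
    MemLp (fun ω => (count j (fun A => ω ∈ E A) : ℝ)) 2 P := by
  simp only [count_eq_sum]
  exact memLp_finsetSum _ fun A _ => h.memLp_indicator (hE A)

theorem integral_count [IsFiniteMeasure P] (h : IsDrivingFamily P n p ν ξ) (j : ℕ)
    {E : Finset (Fin n) → Set Ω} (hE : ∀ A, IsLocal ξ A (E A)) :
    ∫ ω, (count j (fun A => ω ∈ E A) : ℝ) ∂P =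
      ∑ A ∈ (Finset.univ : Finset (Fin n)).powersetCard (j + 1), P.real (E A) := by
  simp only [count_eq_sum]
  rw [integral_finsetSum _ fun A _ => (h.memLp_indicator (hE A)).integrable one_le_two]
  refine Finset.sum_congr rfl fun A _ => ?_
  rw [integral_indicator_const _ (h.measurableSet_of_isLocal (hE A)), smul_eq_mul, mul_one]

variable [IsProbabilityMeasure P]

/-- If every `E A` has probability at most `C n ^ (-e)`, with `e` the total exponent of the faces
of `A`, then the expected number of `A` for which `E A` occurs is at most `C n ^ τ`. -/
theorem integral_count_le (h : IsDrivingFamily P n p ν ξ) (hn : 1 ≤ n) {b : ℕ → ℝ} {j : ℕ} {C : ℝ}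
    (hC : 0 ≤ C) {E : Finset (Fin n) → Set Ω} (hE : ∀ A, IsLocal ξ A (E A))
    (hP : ∀ A, A.card = j + 1 → P.real (E A) ≤ C * (n : ℝ) ^ (-faceExp b (j + 1))) :
    ∫ ω, (count j (fun A => ω ∈ E A) : ℝ) ∂P ≤ C * (n : ℝ) ^ tauReal b j := by
  have hn0 : (0 : ℝ) < n := by exact_mod_cast hn
  rw [h.integral_count j hE]
  refine (Finset.sum_le_sum fun A hA => hP A (Finset.mem_powersetCard.1 hA).2).trans ?_
  rw [Finset.sum_const, nsmul_eq_mul]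
  refine (mul_le_mul_of_nonneg_right (card_powersetCard_univ_le n j) (by positivity)).trans_eq ?_
  rw [tauReal, sub_eq_add_neg, Real.rpow_add hn0, Real.rpow_natCast]
  ring

theorem measureReal_forall_onBy_le (h : IsDrivingFamily P n p ν ξ) (hn : 1 ≤ n) {b : ℕ → ℝ}
    {c T : ℝ} (hc : 1 ≤ c) {S : Finset (Simplex n)} {m : ℕ} (hm : S.card ≤ m)
    (hU : ∀ B ∈ S, P.real {ω | OnBy (fun v => ξ B v ω) T} ≤ c * (n : ℝ) ^ (-b B.dim)) :
    P.real {ω | ∀ B ∈ S, OnBy (fun v => ξ B v ω) T} ≤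
      c ^ m * (n : ℝ) ^ (-∑ B ∈ S, b B.dim) := by
  have h1 := h.measureReal_forall_mem S fun _ => measurableSet_onBy T
  refine (le_of_eq h1).trans ((Finset.prod_le_prod (fun _ _ => measureReal_nonneg) hU).trans ?_)
  rw [prod_mul_rpow hn, Finset.prod_const]
  exact mul_le_mul_of_nonneg_right (pow_le_pow_right₀ hc hm) (by positivity)

/-- With at most one common vertex the covariance vanishes. Otherwise the product of the means is
dropped, and the joint event forces all simplices in `subs A ∪ subs A'` on by `T`, with total
exponent given by inclusion–exclusion. At most one summand is nonzero; the sum over `w` prepares an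
exchange of summations. -/
theorem covariance_le (h : IsDrivingFamily P n p ν ξ) (hn : 1 ≤ n) {b : ℕ → ℝ} (hb : b 0 = 0)
    {j : ℕ} {c T : ℝ} (hc : 1 ≤ c)
    (hU : ∀ B : Simplex n, B.dim ≤ j →
      P.real {ω | OnBy (fun v => ξ B v ω) T} ≤ c * (n : ℝ) ^ (-b B.dim))
    {E : Finset (Fin n) → Set Ω} (hE : ∀ A, IsLocal ξ A (E A))
    (hsub : ∀ A, E A ⊆ {ω | ∀ B ∈ subs A, OnBy (fun v => ξ B v ω) T})
    {A A' : Finset (Fin n)} (hA : A.card = j + 1) (hA' : A'.card = j + 1) :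
    cov[(E A).indicator fun _ => (1 : ℝ), (E A').indicator fun _ => (1 : ℝ); P] ≤
      ∑ w ∈ Finset.Icc 2 (j + 1), if (A ∩ A').card = w then
        c ^ (2 * 2 ^ (j + 1)) * (n : ℝ) ^ (-(2 * faceExp b (j + 1) - faceExp b w)) else 0 := by
  have hn0 : (0 : ℝ) < n := by exact_mod_cast hn
  have hc0 : 0 ≤ c := zero_le_one.trans hc
  have hnn : ∀ w ∈ Finset.Icc 2 (j + 1), 0 ≤ if (A ∩ A').card = w then
        c ^ (2 * 2 ^ (j + 1)) * (n : ℝ) ^ (-(2 * faceExp b (j + 1) - faceExp b w)) else 0 := by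
    intro w _
    split_ifs <;> positivity
  rcases le_or_gt (A ∩ A').card 1 with hw | hw
  · rw [(h.indepFun_of_isLocal (hE A) (hE A') hw).covariance_eq_zero (h.memLp_indicator (hE A))
      (h.memLp_indicator (hE A'))]
    exact Finset.sum_nonneg hnn
  · have hmem : (A ∩ A').card ∈ Finset.Icc 2 (j + 1) :=
      Finset.mem_Icc.2 ⟨hw, (Finset.card_le_card Finset.inter_subset_left).trans hA.le⟩
    refine le_trans ?_ (Finset.single_le_sum hnn hmem)
    rw [if_pos rfl, covariance_eq_sub (h.memLp_indicator (hE A)) (h.memLp_indicator (hE A'))]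
    have h0 : ∀ F : Set Ω, 0 ≤ ∫ ω, F.indicator (fun _ => (1 : ℝ)) ω ∂P := fun F =>
      integral_nonneg fun ω => Set.indicator_nonneg (fun _ _ => zero_le_one) ω
    refine (sub_le_self _ (mul_nonneg (h0 _) (h0 _))).trans ?_
    have hmul : (E A).indicator (fun _ => (1 : ℝ)) * (E A').indicator (fun _ => (1 : ℝ)) =
        (E A ∩ E A').indicator fun _ => (1 : ℝ) := by
      ext ω
      by_cases h1 : ω ∈ E A <;> by_cases h2 : ω ∈ E A' <;> simp [h1, h2]
    rw [hmul, integral_indicator_const _ ((h.measurableSet_of_isLocal (hE A)).inter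
      (h.measurableSet_of_isLocal (hE A'))), smul_eq_mul, mul_one]
    have hS : (subs A ∪ subs A').card ≤ 2 * 2 ^ (j + 1) := by
      refine (Finset.card_union_le _ _).trans ?_
      have h1 := card_subs_le A
      have h2 := card_subs_le A'
      rw [hA] at h1
      rw [hA'] at h2
      omega
    have hle := h.measureReal_forall_onBy_le hn (b := b) (T := T) hc hS fun B hB => hU B (by
      rcases Finset.mem_union.1 hB with hB | hB
      · have := dim_lt_of_mem_subs hB
        omega
      · have := dim_lt_of_mem_subs hB
        omega)
    rw [sum_subs_union hb, hA, hA', ← two_mul] at hle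
    refine (measureReal_mono fun ω hω B hB => ?_).trans hle
    rcases Finset.mem_union.1 hB with hB | hB
    · exact hsub A hω.1 B hB
    · exact hsub A' hω.2 B hB

/-- A given `A` meets at most `2^{j+1} n^{j+1-w}` sets `A'` in exactly `w` vertices, so such pairs
contribute order `n^{2τ_j - τ_{w-1}}`. The factor `j` in `varConst` counts the values of `w` from
`2` to `j + 1`. -/
theorem variance_count_le (h : IsDrivingFamily P n p ν ξ) (hn : 1 ≤ n) {b : ℕ → ℝ} {k : ℕ}
    (hb : Critical b k) {j : ℕ} {c T : ℝ} (hc : 1 ≤ c)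
    (hU : ∀ B : Simplex n, B.dim ≤ j →
      P.real {ω | OnBy (fun v => ξ B v ω) T} ≤ c * (n : ℝ) ^ (-b B.dim))
    {E : Finset (Fin n) → Set Ω} (hE : ∀ A, IsLocal ξ A (E A))
    (hsub : ∀ A, E A ⊆ {ω | ∀ B ∈ subs A, OnBy (fun v => ξ B v ω) T}) :
    Var[fun ω => (count j (fun A => ω ∈ E A) : ℝ); P] ≤
      varConst j c * (n : ℝ) ^ (2 * tauReal b k - tauReal b 1) := by
  have hn0 : (0 : ℝ) < n := by exact_mod_cast hn
  have hn1 : (1 : ℝ) ≤ n := by exact_mod_cast hn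
  have hc0 : 0 ≤ c := zero_le_one.trans hc
  set D : ℝ := c ^ (2 * 2 ^ (j + 1)) with hD
  have hD0 : 0 ≤ D := by positivity
  simp only [count_eq_sum]
  rw [variance_fun_sum' fun A _ => h.memLp_indicator (hE A)]
  have hrow : ∀ A ∈ (Finset.univ : Finset (Fin n)).powersetCard (j + 1),
      ∑ A' ∈ (Finset.univ : Finset (Fin n)).powersetCard (j + 1),
        cov[(E A).indicator fun _ => (1 : ℝ), (E A').indicator fun _ => (1 : ℝ); P] ≤
      ∑ w ∈ Finset.Icc 2 (j + 1), (2 ^ (j + 1) * (n : ℝ) ^ (j + 1 - w)) *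
        (D * (n : ℝ) ^ (-(2 * faceExp b (j + 1) - faceExp b w))) := by
    intro A hA
    have hAc := (Finset.mem_powersetCard.1 hA).2
    refine (Finset.sum_le_sum fun A' hA' => h.covariance_le hn hb.zero hc hU hE hsub hAc
      (Finset.mem_powersetCard.1 hA').2).trans ?_
    rw [Finset.sum_comm]
    refine Finset.sum_le_sum fun w _ => ?_
    rw [← Finset.sum_filter, Finset.sum_const, nsmul_eq_mul]
    refine mul_le_mul_of_nonneg_right ?_ (by positivity)
    have := card_inter_eq_le (m := j + 1) (w := w) A
    rw [hAc] at this
    exact_mod_cast this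
  refine (Finset.sum_le_sum hrow).trans ?_
  rw [Finset.sum_const, nsmul_eq_mul]
  refine (mul_le_mul_of_nonneg_right (card_powersetCard_univ_le n j)
    (Finset.sum_nonneg fun w _ => by positivity)).trans ?_
  rw [Finset.mul_sum]
  have hterm : ∀ w ∈ Finset.Icc 2 (j + 1), (n : ℝ) ^ (j + 1) *
      ((2 ^ (j + 1) * (n : ℝ) ^ (j + 1 - w)) *
        (D * (n : ℝ) ^ (-(2 * faceExp b (j + 1) - faceExp b w)))) ≤
      2 ^ (j + 1) * D * (n : ℝ) ^ (2 * tauReal b k - tauReal b 1) := by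
    intro w hw
    obtain ⟨hw2, hwj⟩ := Finset.mem_Icc.1 hw
    have hexp := hb.variance_exponent_le (l := w - 1) (j := j) (by omega) (by omega)
    have heq : (n : ℝ) ^ (2 * tauReal b j - tauReal b (w - 1)) = (n : ℝ) ^ (j + 1) *
        ((n : ℝ) ^ (j + 1 - w) * (n : ℝ) ^ (-(2 * faceExp b (j + 1) - faceExp b w))) := by
      rw [← Real.rpow_natCast, ← Real.rpow_natCast, ← Real.rpow_add hn0, ← Real.rpow_add hn0]
      congr 1
      unfold tauReal
      rw [show w - 1 + 1 = w by omega, Nat.cast_sub hwj]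
      ring
    calc _ = 2 ^ (j + 1) * D * (n : ℝ) ^ (2 * tauReal b j - tauReal b (w - 1)) := by
          rw [heq]; ring
      _ ≤ _ := mul_le_mul_of_nonneg_left (Real.rpow_le_rpow_of_exponent_le hn1 hexp)
          (by positivity)
  refine (Finset.sum_le_sum hterm).trans_eq ?_
  rw [Finset.sum_const, Nat.card_Icc, nsmul_eq_mul, varConst, show j + 1 + 1 - 2 = j by omega]
  ring

end IsDrivingFamily

/-- A strong law from variance bounds, without any assumption on the joint law. -/
theorem ae_tendsto_of_variance_le {Ω : Type*} [MeasurableSpace Ω] {P : Measure Ω}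
    [IsProbabilityMeasure P] {N : ℕ → Ω → ℝ} (hN : ∀ n, MemLp (N n) 2 P) {a s C : ℝ} (hs : 1 < s)
    (hvar : ∀ n : ℕ, 1 ≤ n → Var[N n; P] ≤ C * (n : ℝ) ^ (2 * a - s)) :
    ∀ᵐ ω ∂P, Tendsto (fun n : ℕ => (N n ω - ∫ ω, N n ω ∂P) / (n : ℝ) ^ a) atTop (𝓝 0) := by
  have hbound : ∀ ε : ℝ, 0 < ε → ∀ᵐ ω ∂P, ∀ᶠ n : ℕ in atTop,
      ω ∉ {ω | ε * (n : ℝ) ^ a ≤ |N n ω - ∫ ω, N n ω ∂P|} := by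
    intro ε hε
    refine ae_eventually_notMem ?_
    have hsum : Summable fun n : ℕ => C / ε ^ 2 * (n : ℝ) ^ (-s) :=
      (Real.summable_nat_rpow.2 (by linarith)).mul_left _
    -- The term `n = 0` is split off, since the variance is bounded only for `n ≥ 1`; a single
    -- probability is finite anyway.
    rw [← summable_nat_add_iff 1] at hsum
    rw [tsum_eq_zero_add' ENNReal.summable]
    refine ENNReal.add_ne_top.2 ⟨measure_ne_top _ _, ?_⟩
    refine ne_top_of_le_ne_top hsum.tsum_ofReal_ne_top (ENNReal.tsum_le_tsum fun n => ?_)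
    have hn0 : (0 : ℝ) < (n + 1 : ℕ) := by positivity
    refine (meas_ge_le_variance_div_sq (hN (n + 1)) (by positivity)).trans
      (ENNReal.ofReal_le_ofReal ?_)
    rw [div_le_iff₀ (by positivity)]
    refine (hvar (n + 1) (by omega)).trans_eq ?_
    rw [show 2 * a - s = a + a + -s by ring, Real.rpow_add hn0, Real.rpow_add hn0]
    field_simp
  have hall : ∀ᵐ ω ∂P, ∀ m : ℕ, ∀ᶠ n : ℕ in atTop,
      ω ∉ {ω | (1 / ((m : ℝ) + 1)) * (n : ℝ) ^ a ≤ |N n ω - ∫ ω, N n ω ∂P|} :=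
    ae_all_iff.2 fun m => hbound _ Nat.one_div_pos_of_nat
  filter_upwards [hall] with ω hω
  rw [Metric.tendsto_nhds]
  intro ε hε
  obtain ⟨m, hm⟩ := exists_nat_one_div_lt hε
  filter_upwards [hω m, eventually_ge_atTop 1] with n hn hn1
  have hn0 : (0 : ℝ) < (n : ℝ) ^ a := Real.rpow_pos_of_pos (by exact_mod_cast hn1) a
  have h1 : |N n ω - ∫ ω, N n ω ∂P| < 1 / ((m : ℝ) + 1) * (n : ℝ) ^ a := not_le.1 hn
  rw [Real.dist_eq, sub_zero, abs_div, abs_of_pos hn0, div_lt_iff₀ hn0]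
  exact h1.trans (mul_lt_mul_of_pos_right hm hn0)

/-! ### Face counts as simplex counts -/

section Counting

variable {n : ℕ}

theorem count_mono {j : ℕ} {q r : Finset (Fin n) → Prop} (h : ∀ A, q A → r A) :
    count j q ≤ count j r := by
  classical
  exact Finset.card_le_card (Finset.monotone_filter_right _ fun A _ => h A)

theorem abs_count_sub_le {j : ℕ} {q q' r : Finset (Fin n) → Prop}
    (h : ∀ A, ¬ (q A ↔ q' A) → r A) : |(count j q : ℝ) - count j q'| ≤ count j r := by
  classical
  have key : ∀ q q' : Finset (Fin n) → Prop, (∀ A, ¬ (q A ↔ q' A) → r A) →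
      count j q ≤ count j q' + count j r := by
    intro q q' h
    unfold count
    refine (Finset.card_le_card fun A hA => ?_).trans (Finset.card_union_le _ _)
    simp only [Finset.mem_filter, Finset.mem_union] at hA ⊢
    have := h A
    tauto
  have h1 : (count j q : ℝ) ≤ count j q' + count j r := by exact_mod_cast key q q' h
  have h2 : (count j q' : ℝ) ≤ count j q + count j r := by
    exact_mod_cast key q' q fun A hA => h A fun h' => hA h'.symm
  rw [abs_le]
  constructor <;> linarith

variable {x : Simplex n → RenewalVar → ℝ}

theorem faceCount_complexAt (hx : ∀ B, GoodPath (x B)) (t : ℝ≥0) (j : ℕ) :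
    faceCount (complexAt x t) j = count j fun A => ∀ B ∈ subs A, OnAt (x B) t := by
  classical
  unfold faceCount count
  rw [← Set.ncard_coe_finset]
  congr 1
  ext A
  simp only [Finset.coe_filter, Finset.mem_powersetCard, Finset.subset_univ, true_and,
    Set.mem_ofPred_eq, mem_subs]
  constructor
  · rintro ⟨⟨-, h1⟩, h2⟩
    exact ⟨h2, fun B hB => ((hx B).onOff_eq_one_iff t).1 (h1 B hB)⟩
  · rintro ⟨h2, h1⟩
    exact ⟨⟨Finset.card_pos.1 (by omega), fun B hB => ((hx B).onOff_eq_one_iff t).2 (h1 B hB)⟩, h2⟩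

theorem faceCount_le_count_onBy (hx : ∀ B, GoodPath (x B)) {t : ℝ≥0} {T : ℝ} (ht : (t : ℝ) ≤ T)
    (j : ℕ) : faceCount (complexAt x t) j ≤ count j fun A => ∀ B ∈ subs A, OnBy (x B) T := by
  rw [faceCount_complexAt hx]
  exact count_mono fun A h B hB => (h B hB).onBy ht

/-- A set whose status differs is a face at `s` or at `u`, hence on by `T`, and one of its simplices
changed value. The bound is the same for all `u` in `[s, t]`, which makes the grid argument uniform.
-/
theorem abs_faceCount_sub_le (hx : ∀ B, GoodPath (x B)) {s u : ℝ≥0} {t T : ℝ} (hsu : s ≤ u)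
    (hut : (u : ℝ) ≤ t) (htT : t ≤ T) (j : ℕ) :
    |(faceCount (complexAt x u) j : ℝ) - faceCount (complexAt x s) j| ≤
      count j fun A => (∀ B ∈ subs A, OnBy (x B) T) ∧ ∃ B ∈ subs A, SwitchIn (x B) s t := by
  have hsu' : (s : ℝ) ≤ u := by exact_mod_cast hsu
  rw [faceCount_complexAt hx, faceCount_complexAt hx]
  refine abs_count_sub_le fun A hA => ⟨?_, ?_⟩
  · rw [not_iff] at hA
    by_cases h : ∀ B ∈ subs A, OnAt (x B) u
    · exact fun B hB => (h B hB).onBy (hut.trans htT)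
    · exact fun B hB => ((hA.1 h) B hB).onBy (by linarith)
  · by_contra hc
    push Not at hc
    refine hA (forall₂_congr fun B hB => ?_)
    by_contra h
    rw [← (hx B).onOff_eq_one_iff, ← (hx B).onOff_eq_one_iff] at h
    exact hc B hB ((hx B).switchIn hsu hut h)

end Counting

/-! ### Local events -/

section Local

variable {Ω : Type*} {n : ℕ} {ξ : Simplex n → RenewalVar → Ω → ℝ} {A : Finset (Fin n)}

theorem isLocal_forall {M : Set (RenewalVar → ℝ)} (hM : MeasurableSet M) :
    IsLocal ξ A {ω | ∀ B ∈ subs A, (fun v => ξ B v ω) ∈ M} := by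
  refine ⟨⋂ B : subs A, (fun f => f B) ⁻¹' M,
    MeasurableSet.iInter fun B => measurable_pi_apply B hM, ?_⟩
  ext ω
  simp

theorem isLocal_exists {M : Set (RenewalVar → ℝ)} (hM : MeasurableSet M) :
    IsLocal ξ A {ω | ∃ B ∈ subs A, (fun v => ξ B v ω) ∈ M} := by
  refine ⟨⋃ B : subs A, (fun f => f B) ⁻¹' M,
    MeasurableSet.iUnion fun B => measurable_pi_apply B hM, ?_⟩
  ext ω
  simp

theorem IsLocal.inter {E F : Set Ω} (hE : IsLocal ξ A E) (hF : IsLocal ξ A F) :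
    IsLocal ξ A (E ∩ F) := by
  obtain ⟨M, hM, rfl⟩ := hE
  obtain ⟨N, hN, rfl⟩ := hF
  exact ⟨M ∩ N, hM.inter hN, rfl⟩

/-- All simplices inside `A` carry the state on before time `T`. -/
def allOnBy (ξ : Simplex n → RenewalVar → Ω → ℝ) (T : ℝ) (A : Finset (Fin n)) : Set Ω :=
  {ω | ∀ B ∈ subs A, OnBy (fun v => ξ B v ω) T}

/-- All simplices inside `A` are on at time `t`. -/
def allOnAt (ξ : Simplex n → RenewalVar → Ω → ℝ) (t : ℝ) (A : Finset (Fin n)) : Set Ω :=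
  {ω | ∀ B ∈ subs A, OnAt (fun v => ξ B v ω) t}

/-- All simplices inside `A` carry the state on before time `T`, and one of them switches
during `(s, t]`. -/
def someSwitch (ξ : Simplex n → RenewalVar → Ω → ℝ) (T s t : ℝ) (A : Finset (Fin n)) : Set Ω :=
  allOnBy ξ T A ∩ {ω | ∃ B ∈ subs A, SwitchIn (fun v => ξ B v ω) s t}

theorem isLocal_allOnBy (T : ℝ) : IsLocal ξ A (allOnBy ξ T A) :=
  isLocal_forall (measurableSet_onBy T)

theorem isLocal_allOnAt (t : ℝ) : IsLocal ξ A (allOnAt ξ t A) :=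
  isLocal_forall (measurableSet_onAt t)

theorem isLocal_someSwitch (T s t : ℝ) : IsLocal ξ A (someSwitch ξ T s t A) :=
  (isLocal_allOnBy T).inter (isLocal_exists (measurableSet_switchIn s t))

theorem allOnAt_subset {t T : ℝ} (ht : t ≤ T) : allOnAt ξ t A ⊆ allOnBy ξ T A :=
  fun _ h B hB => (h B hB).onBy ht

end Local

/-- Union bound over the simplex `C` that switches: `C` contributes `g` in place of `c`, while the
others still have to be on by `T`, so the full exponent survives and the small factor `g` is gained.
-/
theorem IsDrivingFamily.measureReal_someSwitch_le {Ω : Type*} [MeasurableSpace Ω] {P : Measure Ω}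
    [IsProbabilityMeasure P] {n : ℕ} {p : ℕ → ℝ} {ν : ℕ → Measure ℝ}
    {ξ : Simplex n → RenewalVar → Ω → ℝ} (h : IsDrivingFamily P n p ν ξ) (hn : 1 ≤ n)
    {b : ℕ → ℝ} (hb : b 0 = 0) {j : ℕ} {c g T s t : ℝ} (hc : 1 ≤ c) (hg : 0 ≤ g)
    (hU : ∀ B : Simplex n, B.dim ≤ j →
      P.real {ω | OnBy (fun v => ξ B v ω) T} ≤ c * (n : ℝ) ^ (-b B.dim))
    (hV : ∀ B : Simplex n, B.dim ≤ j →
      P.real {ω | SwitchIn (fun v => ξ B v ω) s t} ≤ g * (n : ℝ) ^ (-b B.dim))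
    {A : Finset (Fin n)} (hA : A.card = j + 1) :
    P.real (someSwitch ξ T s t A) ≤
      2 ^ (j + 1) * c ^ 2 ^ (j + 1) * g * (n : ℝ) ^ (-faceExp b (j + 1)) := by
  classical
  have hc0 : 0 ≤ c := zero_le_one.trans hc
  have hcard : (subs A).card ≤ 2 ^ (j + 1) := hA ▸ card_subs_le A
  let M : Simplex n → Simplex n → Set (RenewalVar → ℝ) := fun C B =>
    if B = C then {x | SwitchIn x s t} else {x | OnBy x T}
  have hM : ∀ C B, MeasurableSet (M C B) := fun C B => by
    simp only [M]
    split_ifs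
    · exact measurableSet_switchIn s t
    · exact measurableSet_onBy T
  have hone : ∀ C ∈ subs A, P.real {ω | ∀ B ∈ subs A, (fun v => ξ B v ω) ∈ M C B} ≤
      c ^ 2 ^ (j + 1) * g * (n : ℝ) ^ (-faceExp b (j + 1)) := by
    intro C hC
    rw [h.measureReal_forall_mem (subs A) (hM C)]
    have hfac : ∀ B ∈ subs A, P.real {ω | (fun v => ξ B v ω) ∈ M C B} ≤
        (if B = C then g else c) * (n : ℝ) ^ (-b B.dim) := by
      intro B hB
      have hdim : B.dim ≤ j := by have := dim_lt_of_mem_subs hB; omega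
      simp only [M]
      split_ifs
      · exact hV B hdim
      · exact hU B hdim
    refine (Finset.prod_le_prod (fun _ _ => measureReal_nonneg) hfac).trans ?_
    rw [prod_mul_rpow hn, sum_subs hb, hA]
    refine mul_le_mul_of_nonneg_right ?_ (by positivity)
    rw [← Finset.mul_prod_erase _ _ hC, if_pos rfl, mul_comm]
    refine mul_le_mul_of_nonneg_right ?_ hg
    rw [Finset.prod_congr rfl fun B hB => if_neg (Finset.ne_of_mem_erase hB), Finset.prod_const]
    exact pow_le_pow_right₀ hc ((Finset.card_erase_le).trans hcard)
  have hsub : someSwitch ξ T s t A ⊆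
      ⋃ C ∈ subs A, {ω | ∀ B ∈ subs A, (fun v => ξ B v ω) ∈ M C B} := by
    rintro ω ⟨h1, C, hC, h2⟩
    refine Set.mem_iUnion₂.2 ⟨C, hC, fun B hB => ?_⟩
    by_cases hBC : B = C
    · subst hBC
      simpa [M] using h2
    · simpa [M, hBC] using h1 B hB
  refine (measureReal_mono hsub (measure_ne_top _ _)).trans ((measureReal_biUnion_finset_le _ _).trans
    ((Finset.sum_le_sum hone).trans ?_))
  rw [Finset.sum_const, nsmul_eq_mul]
  have : ((subs A).card : ℝ) ≤ 2 ^ (j + 1) := by exact_mod_cast hcard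
  calc _ ≤ (2 : ℝ) ^ (j + 1) * (c ^ 2 ^ (j + 1) * g * (n : ℝ) ^ (-faceExp b (j + 1))) :=
        mul_le_mul_of_nonneg_right this (by positivity)
    _ = _ := by ring

/-! ### Strong laws for the face counts -/

/-- The factor in the bound for the probability of being on before `T`, for dimensions up
to `j`. -/
def onConst (ν : ℕ → Measure ℝ) (j : ℕ) (T : ℝ) : ℝ :=
  1 + ∑ i ∈ Finset.Icc 1 j, ∑' l, tailBound (ν i) T l

/-- The factor in the bound for the probability of a switch in an interval of length `d`, for
dimensions up to `j`. -/
def switchConst (ν : ℕ → Measure ℝ) (j : ℕ) (T d : ℝ) : ℝ :=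
  ∑ i ∈ Finset.Icc 1 j, IsRenewal.switchBound (ν i) T d

/-- This is what the summand `1` is for: powers of the constant can be raised to an exponent that
does not depend on the number of simplices. -/
theorem one_le_onConst (ν : ℕ → Measure ℝ) (j : ℕ) (T : ℝ) : 1 ≤ onConst ν j T :=
  le_add_of_nonneg_right (Finset.sum_nonneg fun _ _ => tsum_nonneg fun _ => tailBound_nonneg _ _ _)

theorem switchConst_nonneg (ν : ℕ → Measure ℝ) (j : ℕ) (T : ℝ) {d : ℝ} (hd : 0 ≤ d) :
    0 ≤ switchConst ν j T d :=
  Finset.sum_nonneg fun _ _ => IsRenewal.switchBound_nonneg _ _ hd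

theorem tendsto_switchConst {ν : ℕ → Measure ℝ} (hν : ∀ i, 1 ≤ i → IsGapLaw (ν i)) (j : ℕ)
    (T : ℝ) : Tendsto (fun m : ℕ => switchConst ν j T (1 / ((m : ℝ) + 1))) atTop (𝓝 0) := by
  have := tendsto_finsetSum (Finset.Icc 1 j) fun i hi =>
    IsRenewal.tendsto_switchBound (hν i (Finset.mem_Icc.1 hi).1) T
  simpa [switchConst] using this

theorem tendsto_choose_div_pow (m : ℕ) :
    Tendsto (fun n : ℕ => (n.choose m : ℝ) / (n : ℝ) ^ m) atTop (𝓝 (1 / (m ! : ℝ))) := by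
  have h1 := (isEquivalent_choose m).div
    (Asymptotics.IsEquivalent.refl (u := fun n : ℕ => (n : ℝ) ^ m))
  refine (h1.tendsto_nhds_iff).2 (tendsto_const_nhds.congr' ?_)
  filter_upwards [eventually_ge_atTop 1] with n hn
  have : (n : ℝ) ^ m ≠ 0 := by positivity
  simp only [Pi.div_apply]
  field_simp

section StrongLaws

variable {Ω : Type*} [MeasurableSpace Ω] {P : Measure Ω} [IsProbabilityMeasure P]
  {α : ℕ → ℝ≥0∞} {k : ℕ} {ν : ℕ → Measure ℝ}
  {ξ : (n : ℕ) → Simplex n → RenewalVar → Ω → ℝ}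

theorem measureReal_onBy_le_onConst (hν : ∀ i, 1 ≤ i → IsGapLaw (ν i))
    (hξ : ∀ n, IsDrivingFamily P n (fun i => faceProb n (α i)) ν (ξ n)) {n : ℕ} (hn : 1 ≤ n)
    {j : ℕ} {T : ℝ} (hT : 0 ≤ T) (B : Simplex n) (hB : B.dim ≤ j) :
    P.real {ω | OnBy (fun v => ξ n B v ω) T} ≤ onConst ν j T * (n : ℝ) ^ (-cutExp α B.dim) := by
  have h1 := B.one_le_dim
  refine (((hξ n).isRenewal B).measureReal_onBy_le (hν _ h1) hT).trans ?_
  refine mul_le_mul ?_ (faceProb_le_rpow α hn h1) (faceProb_nonneg _ _)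
    (zero_le_one.trans (one_le_onConst _ _ _))
  have := Finset.single_le_sum (f := fun i => ∑' l, tailBound (ν i) T l)
    (fun i _ => tsum_nonneg fun _ => tailBound_nonneg _ _ _) (Finset.mem_Icc.2 ⟨h1, hB⟩)
  unfold onConst
  linarith

theorem measureReal_switchIn_le_switchConst (hν : ∀ i, 1 ≤ i → IsGapLaw (ν i))
    (hξ : ∀ n, IsDrivingFamily P n (fun i => faceProb n (α i)) ν (ξ n)) {n : ℕ} (hn : 1 ≤ n)
    {j : ℕ} {T s t : ℝ} (hs : 0 ≤ s) (hst : s ≤ t) (htT : t ≤ T) (B : Simplex n)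
    (hB : B.dim ≤ j) :
    P.real {ω | SwitchIn (fun v => ξ n B v ω) s t} ≤
      switchConst ν j T (t - s) * (n : ℝ) ^ (-cutExp α B.dim) := by
  have h1 := B.one_le_dim
  have hd := sub_nonneg.2 hst
  refine (((hξ n).isRenewal B).measureReal_switchIn_le (hν _ h1) hs hst htT).trans ?_
  refine mul_le_mul ?_ (faceProb_le_rpow α hn h1) (faceProb_nonneg _ _)
    (switchConst_nonneg _ _ _ hd)
  exact Finset.single_le_sum (f := fun i => IsRenewal.switchBound (ν i) T (t - s))
    (fun i _ => IsRenewal.switchBound_nonneg _ _ hd) (Finset.mem_Icc.2 ⟨h1, hB⟩)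

/-- Counts of local events fluctuate by less than `n ^ τ_k`. -/
theorem ae_tendsto_count_sub (hb : Critical (cutExp α) k) (hν : ∀ i, 1 ≤ i → IsGapLaw (ν i))
    (hξ : ∀ n, IsDrivingFamily P n (fun i => faceProb n (α i)) ν (ξ n)) {T : ℝ} (hT : 0 ≤ T)
    (j : ℕ) {E : (n : ℕ) → Finset (Fin n) → Set Ω} (hE : ∀ n A, IsLocal (ξ n) A (E n A))
    (hsub : ∀ n A, E n A ⊆ allOnBy (ξ n) T A) :
    ∀ᵐ ω ∂P, Tendsto (fun n : ℕ => ((count j (fun A => ω ∈ E n A) : ℝ) -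
      ∫ ω, (count j (fun A => ω ∈ E n A) : ℝ) ∂P) / (n : ℝ) ^ tauReal (cutExp α) k)
      atTop (𝓝 0) :=
  ae_tendsto_of_variance_le (N := fun n ω => (count j (fun A => ω ∈ E n A) : ℝ))
    (fun n => (hξ n).memLp_count j (hE n)) hb.one_lt_tauReal_one fun n hn =>
      (hξ n).variance_count_le hn hb (one_le_onConst ν j T)
        (fun B hB => measureReal_onBy_le_onConst hν hξ hn hT B hB) (hE n) (hsub n)

theorem integral_count_allOnBy_le (hν : ∀ i, 1 ≤ i → IsGapLaw (ν i))
    (hξ : ∀ n, IsDrivingFamily P n (fun i => faceProb n (α i)) ν (ξ n)) {T : ℝ} (hT : 0 ≤ T)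
    (j : ℕ) {n : ℕ} (hn : 1 ≤ n) :
    ∫ ω, (count j (fun A => ω ∈ allOnBy (ξ n) T A) : ℝ) ∂P ≤
      onConst ν j T ^ 2 ^ (j + 1) * (n : ℝ) ^ tauReal (cutExp α) j := by
  have hc := one_le_onConst ν j T
  refine (hξ n).integral_count_le hn (pow_nonneg (zero_le_one.trans hc) _)
    (fun A => isLocal_allOnBy T) fun A hA => ?_
  have h1 := (hξ n).measureReal_forall_onBy_le hn (b := cutExp α) (T := T) hc
    (S := subs A) (hA ▸ card_subs_le A) fun B hB =>
      measureReal_onBy_le_onConst hν hξ hn hT B (by have := dim_lt_of_mem_subs hB; omega)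
  rwa [sum_subs (cutExp_zero α), hA] at h1

/-- Faces of noncritical dimension are negligible, uniformly on bounded time intervals. -/
theorem ae_tendsto_count_allOnBy (hb : Critical (cutExp α) k)
    (hν : ∀ i, 1 ≤ i → IsGapLaw (ν i))
    (hξ : ∀ n, IsDrivingFamily P n (fun i => faceProb n (α i)) ν (ξ n)) {T : ℝ} (hT : 0 ≤ T)
    {j : ℕ} (hj : j ≠ k) :
    ∀ᵐ ω ∂P, Tendsto (fun n : ℕ => (count j (fun A => ω ∈ allOnBy (ξ n) T A) : ℝ) /
      (n : ℝ) ^ tauReal (cutExp α) k) atTop (𝓝 0) := by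
  -- The mean is of order at most `n^{τ_j}`, and `τ_j < τ_k`.
  have hmean : Tendsto (fun n : ℕ => (∫ ω, (count j (fun A => ω ∈ allOnBy (ξ n) T A) : ℝ) ∂P) /
      (n : ℝ) ^ tauReal (cutExp α) k) atTop (𝓝 0) := by
    set C := onConst ν j T ^ 2 ^ (j + 1)
    have hlim : Tendsto (fun n : ℕ => C *
        (n : ℝ) ^ (-(tauReal (cutExp α) k - tauReal (cutExp α) j))) atTop (𝓝 0) := by
      have := ((tendsto_rpow_neg_atTop (sub_pos.2 (hb.tauReal_lt hj))).comp
        tendsto_natCast_atTop_atTop).const_mul C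
      simpa using this
    refine squeeze_zero' (Eventually.of_forall fun n => div_nonneg
      (integral_nonneg fun ω => Nat.cast_nonneg _) (by positivity)) ?_ hlim
    filter_upwards [eventually_ge_atTop 1] with n hn
    have hn0 : (0 : ℝ) < n := by exact_mod_cast hn
    rw [div_le_iff₀ (by positivity), mul_assoc, ← Real.rpow_add hn0]
    refine (integral_count_allOnBy_le hν hξ hT j hn).trans_eq ?_
    congr 2
    ring
  filter_upwards [ae_tendsto_count_sub hb hν hξ hT j (fun n A => isLocal_allOnBy T)
    fun n A => subset_rfl] with ω hω
  have := hω.add hmean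
  rw [add_zero] at this
  refine this.congr fun n => ?_
  rw [← add_div, sub_add_cancel]

/-- There are eventually no faces of high dimension on bounded time intervals. -/
theorem ae_eventually_count_allOnBy_eq_zero (hν : ∀ i, 1 ≤ i → IsGapLaw (ν i))
    (hξ : ∀ n, IsDrivingFamily P n (fun i => faceProb n (α i)) ν (ξ n)) {T : ℝ} (hT : 0 ≤ T)
    {J : ℕ} (hJ : tauReal (cutExp α) J ≤ -2) :
    ∀ᵐ ω ∂P, ∀ᶠ n in atTop, count J (fun A => ω ∈ allOnBy (ξ n) T A) = 0 := by
  set C := onConst ν J T ^ 2 ^ (J + 1)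
  have hC : 0 ≤ C := pow_nonneg (zero_le_one.trans (one_le_onConst ν J T)) _
  have h : ∀ᵐ ω ∂P, ∀ᶠ n in atTop,
      ω ∉ {ω | (1 : ℝ) ≤ count J (fun A => ω ∈ allOnBy (ξ n) T A)} := by
    -- Markov's inequality bounds the probability of a nonzero count by a multiple of `n^{-2}`, so
    -- Borel–Cantelli applies.
    refine ae_eventually_notMem ?_
    have hsum : Summable fun n : ℕ => C * (n : ℝ) ^ (-2 : ℝ) :=
      (Real.summable_nat_rpow.2 (by norm_num)).mul_left _
    rw [← summable_nat_add_iff 1] at hsum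
    rw [tsum_eq_zero_add' ENNReal.summable]
    refine ENNReal.add_ne_top.2 ⟨measure_ne_top _ _, ?_⟩
    refine ne_top_of_le_ne_top hsum.tsum_ofReal_ne_top (ENNReal.tsum_le_tsum fun n => ?_)
    rw [← ofReal_measureReal]
    refine ENNReal.ofReal_le_ofReal ?_
    have h1 := mul_meas_ge_le_integral_of_nonneg (μ := P)
      (f := fun ω => (count J (fun A => ω ∈ allOnBy (ξ (n + 1)) T A) : ℝ))
      (Eventually.of_forall fun ω => Nat.cast_nonneg _)
      (((hξ (n + 1)).memLp_count J fun A => isLocal_allOnBy T).integrable one_le_two) 1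
    rw [one_mul] at h1
    refine h1.trans ((integral_count_allOnBy_le hν hξ hT J (by omega)).trans ?_)
    exact mul_le_mul_of_nonneg_left
      (Real.rpow_le_rpow_of_exponent_le (by exact_mod_cast Nat.le_add_left 1 n) hJ) hC
  filter_upwards [h] with ω hω
  filter_upwards [hω] with n hn
  have h2 : (count J (fun A => ω ∈ allOnBy (ξ n) T A) : ℝ) < 1 := not_le.1 hn
  have h3 : count J (fun A => ω ∈ allOnBy (ξ n) T A) < 1 := by exact_mod_cast h2
  omega

theorem integral_count_allOnAt (hα : α ∈ critRegion k) (hν : ∀ i, 1 ≤ i → IsGapLaw (ν i))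
    (hξ : ∀ n, IsDrivingFamily P n (fun i => faceProb n (α i)) ν (ξ n)) {t : ℝ} (ht : 0 ≤ t)
    {n : ℕ} (hn : 1 ≤ n) :
    ∫ ω, (count k (fun A => ω ∈ allOnAt (ξ n) t A) : ℝ) ∂P =
      n.choose (k + 1) * (n : ℝ) ^ (-faceExp (cutExp α) (k + 1)) := by
  rw [(hξ n).integral_count k fun A => isLocal_allOnAt t]
  have h1 : ∀ A ∈ (Finset.univ : Finset (Fin n)).powersetCard (k + 1),
      P.real (allOnAt (ξ n) t A) = (n : ℝ) ^ (-faceExp (cutExp α) (k + 1)) := by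
    intro A hA
    have hAc := (Finset.mem_powersetCard.1 hA).2
    have h2 := (hξ n).measureReal_forall_mem (subs A) fun _ => measurableSet_onAt t
    refine Eq.trans h2 ?_
    have h3 : ∀ B ∈ subs A, P.real {ω | (fun v => ξ n B v ω) ∈ {x | OnAt x t}} =
        1 * (n : ℝ) ^ (-cutExp α B.dim) := by
      intro B hB
      have hd := dim_lt_of_mem_subs hB
      rw [one_mul, ← faceProb_eq_rpow α B.one_le_dim
        (le_two_of_mem_critRegion hα B.one_le_dim (by omega))]
      exact ((hξ n).isRenewal B).measureReal_onAt (hν _ B.one_le_dim) ht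
    rw [Finset.prod_congr rfl h3, prod_mul_rpow hn, sum_subs (cutExp_zero α), hAc]
    simp
  rw [Finset.sum_congr rfl h1, Finset.sum_const, nsmul_eq_mul, Finset.card_powersetCard,
    Finset.card_univ, Fintype.card_fin]

/-- The strong law for the faces of critical dimension at a fixed time. -/
theorem ae_tendsto_count_allOnAt (hα : α ∈ critRegion k) (hb : Critical (cutExp α) k)
    (hν : ∀ i, 1 ≤ i → IsGapLaw (ν i))
    (hξ : ∀ n, IsDrivingFamily P n (fun i => faceProb n (α i)) ν (ξ n)) {t : ℝ} (ht : 0 ≤ t) :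
    ∀ᵐ ω ∂P, Tendsto (fun n : ℕ => (count k (fun A => ω ∈ allOnAt (ξ n) t A) : ℝ) /
      (n : ℝ) ^ tauReal (cutExp α) k) atTop (𝓝 (1 / ((k + 1)! : ℝ))) := by
  have hmean : Tendsto (fun n : ℕ => (∫ ω, (count k (fun A => ω ∈ allOnAt (ξ n) t A) : ℝ) ∂P) /
      (n : ℝ) ^ tauReal (cutExp α) k) atTop (𝓝 (1 / ((k + 1)! : ℝ))) := by
    refine (tendsto_choose_div_pow (k + 1)).congr' ?_
    filter_upwards [eventually_ge_atTop 1] with n hn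
    have hn0 : (0 : ℝ) < n := by exact_mod_cast hn
    rw [integral_count_allOnAt hα hν hξ ht hn, tauReal, sub_eq_add_neg, Real.rpow_add hn0,
      Real.rpow_natCast, mul_div_mul_right _ _ (Real.rpow_pos_of_pos hn0 _).ne']
  filter_upwards [ae_tendsto_count_sub hb hν hξ ht k (fun n A => isLocal_allOnAt t)
    fun n A => allOnAt_subset le_rfl] with ω hω
  have := hω.add hmean
  rw [zero_add] at this
  refine this.congr fun n => ?_
  rw [← add_div, sub_add_cancel]

theorem ae_eventually_count_someSwitch_le (hb : Critical (cutExp α) k)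
    (hν : ∀ i, 1 ≤ i → IsGapLaw (ν i))
    (hξ : ∀ n, IsDrivingFamily P n (fun i => faceProb n (α i)) ν (ξ n)) {T s t : ℝ}
    (hs : 0 ≤ s) (hst : s ≤ t) (htT : t ≤ T) {δ : ℝ}
    (hδ : 2 ^ (k + 1) * onConst ν k T ^ 2 ^ (k + 1) * switchConst ν k T (t - s) < δ) :
    ∀ᵐ ω ∂P, ∀ᶠ n : ℕ in atTop, (count k (fun A => ω ∈ someSwitch (ξ n) T s t A) : ℝ) /
      (n : ℝ) ^ tauReal (cutExp α) k ≤ δ := by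
  set D := 2 ^ (k + 1) * onConst ν k T ^ 2 ^ (k + 1) * switchConst ν k T (t - s) with hD
  have hT : 0 ≤ T := hs.trans (hst.trans htT)
  have hc := one_le_onConst ν k T
  have hg := switchConst_nonneg ν k T (sub_nonneg.2 hst)
  have hD0 : 0 ≤ D := by
    have := zero_le_one.trans hc
    positivity
  filter_upwards [ae_tendsto_count_sub hb hν hξ hT k (fun n A => isLocal_someSwitch T s t)
    fun n A => Set.inter_subset_left] with ω hω
  filter_upwards [hω.eventually (eventually_lt_nhds (sub_pos.2 hδ)), eventually_ge_atTop 1]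
    with n h1 hn
  have hn0 : (0 : ℝ) < n := by exact_mod_cast hn
  have hmean := (hξ n).integral_count_le hn (j := k) hD0 (fun A => isLocal_someSwitch T s t)
    fun A hA => (hξ n).measureReal_someSwitch_le hn (cutExp_zero α) hc hg
      (fun B hB => measureReal_onBy_le_onConst hν hξ hn hT B hB)
      (fun B hB => measureReal_switchIn_le_switchConst hν hξ hn hs hst htT B hB) hA
  rw [sub_div] at h1
  have h2 : (∫ ω, (count k (fun A => ω ∈ someSwitch (ξ n) T s t A) : ℝ) ∂P) /
      (n : ℝ) ^ tauReal (cutExp α) k ≤ D := by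
    rw [div_le_iff₀ (by positivity)]
    exact hmean
  linarith

theorem ae_forall_goodPath (hν : ∀ i, 1 ≤ i → IsGapLaw (ν i))
    (hξ : ∀ n, IsDrivingFamily P n (fun i => faceProb n (α i)) ν (ξ n)) :
    ∀ᵐ ω ∂P, ∀ n B, GoodPath fun v => ξ n B v ω :=
  ae_all_iff.2 fun n => ae_all_iff.2 fun B =>
    ((hξ n).isRenewal B).ae_goodPath (hν _ B.one_le_dim)

/-- The strong law for the faces of critical dimension, uniformly on bounded time intervals. -/
theorem ae_eventually_abs_faceCount_sub_le (hα : α ∈ critRegion k) (hb : Critical (cutExp α) k)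
    (hν : ∀ i, 1 ≤ i → IsGapLaw (ν i))
    (hξ : ∀ n, IsDrivingFamily P n (fun i => faceProb n (α i)) ν (ξ n)) (N : ℕ) {ε : ℝ}
    (hε : 0 < ε) :
    ∀ᵐ ω ∂P, ∀ᶠ n : ℕ in atTop, ∀ t : ℝ≥0, (t : ℝ) ≤ N →
      |(faceCount (complexAt (fun B v => ξ n B v ω) t) k : ℝ) /
        (n : ℝ) ^ tauReal (cutExp α) k - 1 / ((k + 1)! : ℝ)| ≤ ε := by
  -- The extra unit leaves room for the grid cell that starts at time `N`.
  set T : ℝ := N + 1 with hT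
  -- The mesh `1/(m+1)` is chosen independently of `n`, so fine that the mean number of sets with a
  -- switch in one cell is below `(ε/2) n^{τ_k}`.
  obtain ⟨m, hm⟩ : ∃ m : ℕ, 2 ^ (k + 1) * onConst ν k T ^ 2 ^ (k + 1) *
      switchConst ν k T (1 / ((m : ℝ) + 1)) < ε / 2 := by
    have := (tendsto_switchConst hν k T).const_mul (2 ^ (k + 1) * onConst ν k T ^ 2 ^ (k + 1))
    rw [mul_zero] at this
    exact (this.eventually (eventually_lt_nhds (half_pos hε))).exists
  set M : ℝ := (m : ℝ) + 1 with hM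
  have hM0 : 0 < M := by positivity
  have hgrid : ∀ᵐ ω ∂P, ∀ i ∈ Finset.range (N * (m + 1) + 1), ∀ᶠ n : ℕ in atTop,
      |(count k (fun A => ω ∈ allOnAt (ξ n) (i / M) A) : ℝ) /
        (n : ℝ) ^ tauReal (cutExp α) k - 1 / ((k + 1)! : ℝ)| ≤ ε / 2 ∧
      (count k (fun A => ω ∈ someSwitch (ξ n) T (i / M) ((i + 1) / M) A) : ℝ) /
        (n : ℝ) ^ tauReal (cutExp α) k ≤ ε / 2 := by
    refine (Finset.eventually_all _).2 fun i hi => ?_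
    have hiN : (i : ℝ) ≤ N * M := by
      have : i ≤ N * (m + 1) := by have := Finset.mem_range.1 hi; omega
      rw [hM]
      exact_mod_cast this
    have h1 : (0 : ℝ) ≤ i / M := by positivity
    have h2 : (i : ℝ) / M ≤ (i + 1) / M := by gcongr; linarith
    have h3 : ((i : ℝ) + 1) / M ≤ T := by
      rw [div_le_iff₀ hM0, hT]
      have : 1 ≤ M := by rw [hM]; linarith [(Nat.cast_nonneg m : (0 : ℝ) ≤ m)]
      linarith
    have h4 : ((i : ℝ) + 1) / M - i / M = 1 / M := by ring
    filter_upwards [ae_tendsto_count_allOnAt hα hb hν hξ h1,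
      ae_eventually_count_someSwitch_le hb hν hξ h1 h2 h3 (δ := ε / 2) (by rw [h4]; exact hm)]
      with ω hω1 hω2
    filter_upwards [hω2, (Metric.tendsto_nhds.1 hω1) (ε / 2) (half_pos hε)] with n h5 h6
    exact ⟨h6.le, h5⟩
  filter_upwards [hgrid, ae_forall_goodPath hν hξ] with ω hω hgood
  filter_upwards [(Finset.eventually_all _).2 hω, eventually_ge_atTop 1] with n hn hn1 t ht
  have hn0 : (0 : ℝ) < (n : ℝ) ^ tauReal (cutExp α) k :=
    Real.rpow_pos_of_pos (by exact_mod_cast hn1) _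
  -- The grid cell `[i/M, (i+1)/M)` contains `t`; half of `ε` pays for its left endpoint `s`, half
  -- for the change from `s` to `t`.
  set i := ⌊(t : ℝ) * M⌋₊ with hi
  have ht0 : (0 : ℝ) ≤ t := t.2
  have hi1 : (i : ℝ) ≤ t * M := Nat.floor_le (by positivity)
  have hi2 : (t : ℝ) * M < i + 1 := Nat.lt_floor_add_one _
  have hiN : i < N * (m + 1) + 1 := by
    have : (i : ℝ) ≤ (N * (m + 1) : ℕ) := by
      push_cast
      exact hi1.trans (mul_le_mul_of_nonneg_right ht hM0.le)
    have : i ≤ N * (m + 1) := by exact_mod_cast this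
    omega
  obtain ⟨h1, h2⟩ := hn i (Finset.mem_range.2 hiN)
  let s : ℝ≥0 := ⟨i / M, by positivity⟩
  have hst : s ≤ t := by
    rw [← NNReal.coe_le_coe]
    exact (div_le_iff₀ hM0).2 hi1
  have h3 : ((i : ℝ) + 1) / M ≤ T := by
    rw [div_le_iff₀ hM0, hT]
    have : 1 ≤ M := by rw [hM]; linarith [(Nat.cast_nonneg m : (0 : ℝ) ≤ m)]
    nlinarith
  have h4 := abs_faceCount_sub_le (hgood n) hst ((le_div_iff₀ hM0).2 hi2.le) h3 k
  have h5 : (faceCount (complexAt (fun B v => ξ n B v ω) s) k : ℝ) =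
      count k (fun A => ω ∈ allOnAt (ξ n) (i / M) A) := by
    rw [faceCount_complexAt (hgood n)]
    rfl
  have h6 : |(faceCount (complexAt (fun B v => ξ n B v ω) t) k : ℝ) /
      (n : ℝ) ^ tauReal (cutExp α) k - (faceCount (complexAt (fun B v => ξ n B v ω) s) k : ℝ) /
      (n : ℝ) ^ tauReal (cutExp α) k| ≤ ε / 2 := by
    rw [← sub_div, abs_div, abs_of_pos hn0]
    exact (div_le_div_of_nonneg_right h4 hn0.le).trans h2
  rw [← h5] at h1
  have := abs_sub_le ((faceCount (complexAt (fun B v => ξ n B v ω) t) k : ℝ) /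
      (n : ℝ) ^ tauReal (cutExp α) k) ((faceCount (complexAt (fun B v => ξ n B v ω) s) k : ℝ) /
      (n : ℝ) ^ tauReal (cutExp α) k) (1 / ((k + 1)! : ℝ))
  linarith

end StrongLaws

/-! ### The limit theorems -/

/-- If a functional of the complex deviates from a multiple of the critical face count by at most
finitely many noncritical face counts, then it obeys the same strong law. -/
theorem tendsto_cadlag_of_faceCount {x : (n : ℕ) → Simplex n → RenewalVar → ℝ}
    (hx : ∀ n B, GoodPath (x n B)) {k : ℕ} {a c : ℝ} (σ : ℝ) (hσ : |σ| ≤ 1)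
    (hface : ∀ N m : ℕ, ∀ᶠ n : ℕ in atTop, ∀ t : ℝ≥0, (t : ℝ) ≤ N →
      |(faceCount (complexAt (x n) t) k : ℝ) / (n : ℝ) ^ a - c| ≤ 1 / ((m : ℝ) + 1))
    (hother : ∀ N j : ℕ, j ≠ k → Tendsto (fun n : ℕ =>
      (count j (fun A => ∀ B ∈ subs A, OnBy (x n B) N) : ℝ) / (n : ℝ) ^ a) atTop (𝓝 0))
    (F : (n : ℕ) → AbstractSimplicialComplex (Fin n) → ℝ) (s : Finset ℕ) (hs : k ∉ s)
    (hF : ∀ N : ℕ, ∀ᶠ n : ℕ in atTop, ∀ t : ℝ≥0, (t : ℝ) ≤ N →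
      |F n (complexAt (x n) t) - σ * faceCount (complexAt (x n) t) k| ≤
        ∑ j ∈ s, (faceCount (complexAt (x n) t) j : ℝ)) :
    Tendsto (fun n => cadlagOfComplex (hx n) fun X => F n X / (n : ℝ) ^ a) atTop
      (𝓝 (Cadlag.const (σ * c))) := by
  refine Cadlag.tendsto_const fun ε hε T => ?_
  obtain ⟨N, hN⟩ := exists_nat_ge (T : ℝ)
  obtain ⟨m, hm⟩ := exists_nat_one_div_lt (half_pos hε)
  have hsum : Tendsto (fun n : ℕ => ∑ j ∈ s,
      (count j (fun A => ∀ B ∈ subs A, OnBy (x n B) N) : ℝ) / (n : ℝ) ^ a) atTop (𝓝 0) := by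
    have := tendsto_finsetSum s fun j hj => hother N j fun h => hs (h ▸ hj)
    simpa using this
  filter_upwards [hface N m, hF N, hsum.eventually (eventually_lt_nhds (half_pos hε)),
    eventually_ge_atTop 1] with n h1 h2 h3 hn t ht
  have hn0 : (0 : ℝ) < (n : ℝ) ^ a := Real.rpow_pos_of_pos (by exact_mod_cast hn) _
  have htN : (t : ℝ) ≤ N := le_trans (by exact_mod_cast ht) hN
  change |F n (complexAt (x n) t) / (n : ℝ) ^ a - σ * c| ≤ ε
  set X := complexAt (x n) t
  have h4 : |F n X - σ * faceCount X k| / (n : ℝ) ^ a ≤ ε / 2 := by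
    refine le_trans ?_ h3.le
    rw [← Finset.sum_div]
    refine div_le_div_of_nonneg_right ((h2 t htN).trans (Finset.sum_le_sum fun j _ => ?_)) hn0.le
    exact_mod_cast faceCount_le_count_onBy (hx n) htN j
  have h5 : |σ * ((faceCount X k : ℝ) / (n : ℝ) ^ a - c)| ≤ ε / 2 := by
    rw [abs_mul]
    have := h1 t htN
    have h6 := mul_le_mul hσ this (abs_nonneg _) zero_le_one
    linarith
  have h7 : F n X / (n : ℝ) ^ a - σ * c = (F n X - σ * faceCount X k) / (n : ℝ) ^ a +
      σ * ((faceCount X k : ℝ) / (n : ℝ) ^ a - c) := by ring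
  rw [h7]
  refine (abs_add_le _ _).trans ?_
  rw [abs_div, abs_of_pos hn0]
  linarith

end DynComplex

end

/-- Strong laws of large numbers in `D[0,∞)` for the Euler characteristic and the critical
Betti number. For each `n` the complex on `n` vertices is driven by the family `ξ n`; nothing is
assumed on the joint law of the families for different `n`. -/
theorem theorem4p1 {Ω : Type*} [MeasurableSpace Ω] (P : Measure Ω) [IsProbabilityMeasure P]
    (K : Type*) [Field K]
    (α : ℕ → ℝ≥0∞) (k : ℕ) (hα : α ∈ DynComplex.critRegion k)
    (hqk : DynComplex.lowestDim α ≤ k)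
    (ν : ℕ → Measure ℝ) [∀ i, IsProbabilityMeasure (ν i)]
    (hν_pos : ∀ i, 1 ≤ i → ∀ᵐ x ∂(ν i), 0 < x)
    (hν_mean : ∀ i, 1 ≤ i → Integrable (fun x => x) (ν i))
    (hν_half : ∃ a : ℝ, 0 < a ∧ ∀ i, DynComplex.lowestDim α ≤ i → cdf (ν i) a ≤ 1 / 2)
    (ξ : (n : ℕ) → DynComplex.Simplex n → DynComplex.RenewalVar → Ω → ℝ)
    (hξ : ∀ n, DynComplex.IsDrivingFamily P n
      (fun i => DynComplex.faceProb n (α i)) ν (ξ n)) :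
    (∀ᵐ ω ∂P, ∃ Y : ℕ → DynComplex.Cadlag,
      (∀ n t, (Y n).toFun t =
        (DynComplex.eulerChar (DynComplex.complexAt (fun A v => ξ n A v ω) t) : ℝ) /
          (n : ℝ) ^ (DynComplex.tau α k).toReal) ∧
      Tendsto Y atTop (𝓝 (DynComplex.Cadlag.const ((-1) ^ k / ((k + 1)! : ℝ))))) ∧
    (∀ᵐ ω ∂P, ∃ Y : ℕ → DynComplex.Cadlag,
      (∀ n t, (Y n).toFun t =
        (DynComplex.betti K (DynComplex.complexAt (fun A v => ξ n A v ω) t) k : ℝ) /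
          (n : ℝ) ^ (DynComplex.tau α k).toReal) ∧
      Tendsto Y atTop (𝓝 (DynComplex.Cadlag.const (1 / ((k + 1)! : ℝ))))) := by
  -- Positivity of `k` gives `τ_1 > τ_0 = 1` and makes `k - 1` a genuine dimension.
  have hk : 1 ≤ k := (DynComplex.one_le_lowestDim hα).trans hqk
  have hb := DynComplex.critical_cutExp hα hk
  have hν : ∀ i, 1 ≤ i → DynComplex.IsGapLaw (ν i) := fun i hi => ⟨inferInstance, hν_pos i hi⟩
  obtain ⟨J, hJ⟩ := hb.exists_tauReal_le (-2)
  -- Horizons and tolerances run through countable sets, so one null set serves them all.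
  have hface := ae_all_iff.2 fun N : ℕ => ae_all_iff.2 fun m : ℕ =>
    DynComplex.ae_eventually_abs_faceCount_sub_le hα hb hν hξ N
      (Nat.one_div_pos_of_nat (α := ℝ) (n := m))
  have hother := ae_all_iff.2 fun N : ℕ => ae_all_iff.2 fun j : ℕ => eventually_imp_distrib_left.2
    fun hj : j ≠ k => DynComplex.ae_tendsto_count_allOnBy hb hν hξ (Nat.cast_nonneg N) hj
  have hhigh := ae_all_iff.2 fun N : ℕ =>
    DynComplex.ae_eventually_count_allOnBy_eq_zero hν hξ (Nat.cast_nonneg N) hJ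
  rw [DynComplex.toReal_tau hα]
  constructor
  · filter_upwards [DynComplex.ae_forall_goodPath hν hξ, hface, hother, hhigh]
      with ω hgood h1 h2 h3
    have h4 := DynComplex.tendsto_cadlag_of_faceCount hgood ((-1) ^ k) (by simp) h1 h2
      (fun n X => (DynComplex.eulerChar X : ℝ)) ((Finset.range J).erase k)
      (Finset.notMem_erase k _) fun N => by
        filter_upwards [h3 N, eventually_gt_atTop k] with n hn hnk t ht
        refine DynComplex.abs_eulerChar_sub_le _ hnk (Nat.le_zero.1 ?_)
        exact (DynComplex.faceCount_le_count_onBy (hgood n) ht J).trans_eq hn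
    rw [mul_one_div] at h4
    exact ⟨_, fun n t => rfl, h4⟩
  · filter_upwards [DynComplex.ae_forall_goodPath hν hξ, hface, hother] with ω hgood h1 h2
    have h4 := DynComplex.tendsto_cadlag_of_faceCount hgood 1 (by simp) h1 h2
      (fun n X => (DynComplex.betti K X k : ℝ)) {k - 1, k + 1}
      (by simp; omega) fun N => by
        refine Eventually.of_forall fun n t _ => ?_
        rw [Finset.sum_pair (by omega), one_mul, abs_le]
        -- With `k = l + 1`, the bounds `f_k - f_{k-1} - f_{k+1} ≤ β_k ≤ f_k` leave only the two
        -- neighbouring face counts as error.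
        obtain ⟨l, rfl⟩ := Nat.exists_eq_add_of_le' hk
        have h5 := DynComplex.betti_le (DynComplex.complexAt (fun B v => ξ n B v ω) t) K (l + 1)
        have h6 := DynComplex.le_betti (DynComplex.complexAt (fun B v => ξ n B v ω) t) K l
        have h5' := (Nat.cast_le (α := ℝ)).2 h5
        have h6' := (Nat.cast_le (α := ℝ)).2 h6
        push_cast at h6'
        simp only [Nat.add_sub_cancel]
        constructor <;> linarith [Nat.cast_nonneg (α := ℝ) (DynComplex.faceCount
          (DynComplex.complexAt (fun B v => ξ n B v ω) t) l), Nat.cast_nonneg (α := ℝ)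
          (DynComplex.faceCount (DynComplex.complexAt (fun B v => ξ n B v ω) t) (l + 1 + 1))]
    rw [one_mul] at h4
    exact ⟨_, fun n t => rfl, h4⟩
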